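/- Let $k_1,k_2,k_3,k_4,\gamma>0$, and consider on $\mathbb{R}$ the Cauchy problem for the unknown $U=(v,u,z,y,\phi,\theta,\eta)^T$ (a laminated Timoshenko beam with heat conduction of Fourier type acting on the slip equation, $(\tau_1,\tau_2,\tau_3)=(0,0,1)$) $$\begin{cases} v_t-u_x-y-\theta=0,\\ u_t-k_1v_x=0,\\ z_t-y_x=0,\\ y_t-k_2z_x+k_1v=0,\\ \phi_t-\theta_x=0,\\ \theta_t-k_3\phi_x+k_1v+\gamma\eta_x=0,\\ \eta_t-k_4\eta_{xx}+\gamma\theta_x=0,\end{cases}\qquad U(\cdot,0)=U_0 .$$ Let $N,\ell$ be integers with $1\le\ell\le N$ and let $j\in\{0,\dots,N-\ell\}$. Then there exist constants $c_0,\tilde c_0>0$, depending only on $k_1,k_2,k_3,k_4,\gamma,N,\ell,j$, such that for every ($\mathbb{C}^7$-valued) $U_0\in H^N(\mathbb{R})\cap L^1(\mathbb{R})$ and the solution $U\in C([0,\infty);L^2(\mathbb{R}))$ of the problem (the equations being satisfied for $t>0$ with space derivatives in the sense of distributions, tested against Schwartz functions of $x$), the derivative $\partial_x^jU(\cdot,t)$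 belongs to $L^2(\mathbb{R})$ for every $t\ge 0$ and: if $k_1=k_2=k_3$, then for all $t\ge0$ $$\|\partial_x^jU(\cdot,t)\|_{L^2(\mathbb{R})}\le c_0(1+t)^{-1/8-j/4}\|U_0\|_{L^1(\mathbb{R})}+c_0e^{-\tilde c_0t}\|\partial_x^{j+\ell}U_0\|_{L^2(\mathbb{R})};$$ otherwise, for all $t\ge0$ $$\|\partial_x^jU(\cdot,t)\|_{L^2(\mathbb{R})}\le c_0(1+t)^{-1/8-j/4}\|U_0\|_{L^1(\mathbb{R})}+c_0(1+t)^{-\ell/4}\|\partial_x^{j+\ell}U_0\|_{L^2(\mathbb{R})}.$$ -/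

import Mathlib

open MeasureTheory
open scoped SchwartzMap

noncomputable section

namespace LaminatedBeam

/-- Values of the unknown `U = (v, u, z, y, φ, θ, η)`; the norm is the Euclidean one. -/
abbrev State : Type := EuclideanSpace ℂ (Fin 7)

/-- `L²(ℝ)` with values in the state space. -/
abbrev L2 : Type := Lp State 2 (volume : Measure ℝ)

/-- The parameters of the laminated Timoshenko beam with heat conduction of Fourier type. -/
structure Params where
  k₁ : ℝ
  k₂ : ℝ
  k₃ : ℝ
  k₄ : ℝ
  γ : ℝ
  hk₁ : 0 < k₁
  hk₂ : 0 < k₂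
  hk₃ : 0 < k₃
  hk₄ : 0 < k₄
  hγ : 0 < γ

/-- The coefficient of `U_xx`: the last component of `A₂ U_xx` is `-k₄ η_xx`, the others vanish. -/
def A₂ (p : Params) : Matrix (Fin 7) (Fin 7) ℂ :=
  !![0, 0, 0, 0, 0, 0, 0;
     0, 0, 0, 0, 0, 0, 0;
     0, 0, 0, 0, 0, 0, 0;
     0, 0, 0, 0, 0, 0, 0;
     0, 0, 0, 0, 0, 0, 0;
     0, 0, 0, 0, 0, 0, 0;
     0, 0, 0, 0, 0, 0, -(p.k₄ : ℂ)]

/-- The coefficient of `U_x`: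
`A₁ U_x = (-u_x, -k₁ v_x + τ₁ γ η_x, -y_x, -k₂ z_x + τ₂ γ η_x, -θ_x, -k₃ φ_x + τ₃ γ η_x,
γ (τ₁ u_x + τ₂ y_x + τ₃ θ_x))`. -/
def A₁ (p : Params) (τ₁ τ₂ τ₃ : ℝ) : Matrix (Fin 7) (Fin 7) ℂ :=
  !![0, -1, 0, 0, 0, 0, 0;
     -(p.k₁ : ℂ), 0, 0, 0, 0, 0, (τ₁ : ℂ) * p.γ;
     0, 0, 0, -1, 0, 0, 0;
     0, 0, -(p.k₂ : ℂ), 0, 0, 0, (τ₂ : ℂ) * p.γ;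
     0, 0, 0, 0, 0, -1, 0;
     0, 0, 0, 0, -(p.k₃ : ℂ), 0, (τ₃ : ℂ) * p.γ;
     0, (p.γ : ℂ) * τ₁, 0, (p.γ : ℂ) * τ₂, 0, (p.γ : ℂ) * τ₃, 0]

/-- The zeroth-order coefficient: `A₀ U = (-y - θ, 0, 0, k₁ v, 0, k₁ v, 0)`. -/
def A₀ (p : Params) : Matrix (Fin 7) (Fin 7) ℂ :=
  !![0, 0, 0, -1, 0, -1, 0;
     0, 0, 0, 0, 0, 0, 0;
     0, 0, 0, 0, 0, 0, 0;
     (p.k₁ : ℂ), 0, 0, 0, 0, 0, 0;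
     0, 0, 0, 0, 0, 0, 0;
     (p.k₁ : ℂ), 0, 0, 0, 0, 0, 0;
     0, 0, 0, 0, 0, 0, 0]

/-- The `n`-th distributional derivative `∂ₓⁿ f` of an `L²` function. -/
def dx (n : ℕ) (f : L2) : 𝓢'(ℝ, State) :=
  (TemperedDistribution.derivCLM State)^[n] (f : 𝓢'(ℝ, State))

/-- `U` is the solution in `C([0, ∞); L²(ℝ))` of the Cauchy problem
`U_t + A₂ U_xx + A₁ U_x + A₀ U = 0` for `t > 0`, `U(·, 0) = U₀`. The space derivatives are
distributional, and the equation holds when tested against every Schwartz function of `x`.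
Only the values of `U` at times `t ≥ 0` matter. -/
structure IsSolution (p : Params) (τ₁ τ₂ τ₃ : ℝ) (U₀ : L2) (U : ℝ → L2) : Prop where
  continuousOn : ContinuousOn U (Set.Ici 0)
  initial : U 0 = U₀
  equation : ∀ t : ℝ, 0 < t → ∀ χ : 𝓢(ℝ, ℂ),
    HasDerivAt (fun s : ℝ => dx 0 (U s) χ)
      (-(Matrix.toEuclideanCLM (𝕜 := ℂ) (A₂ p) (dx 2 (U t) χ)
        + Matrix.toEuclideanCLM (𝕜 := ℂ) (A₁ p τ₁ τ₂ τ₃) (dx 1 (U t) χ)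
        + Matrix.toEuclideanCLM (𝕜 := ℂ) (A₀ p) (dx 0 (U t) χ))) t

end LaminatedBeam

end

/-! After a Fourier transform in `x` the problem is a linear ODE on `ℂ⁷` at each frequency `ω`, and
by Plancherel everything reduces to the size of its `flow`. The physical energy is dissipated only
through `η`, at the rate `2 k₄ ω² |η|²`. The coupling transmits this damping to `θ`, then `φ`, `v`
and finally `y, z, u`: each step integrates the derivative of a product of components, weighted by a
power of `ω`, in which one square appears with a good sign and the other terms are already under
control. `Absorbed` records such control with constants uniform in `ω`, and `Absorbed.decay` turns a
full set of controlled squares into a Lyapunov functional.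

How many powers of `ω` are lost determines the rates: `ω ^ 4` for `|ω| ≤ 1`
(`Trajectory.low_decay`); `ω ^ (-4)` for `|ω| ≥ 1` (`Trajectory.high_decay`); and a constant rate
there if the speeds agree, since the terms causing the loss have factors `k₃ - k₁` and `k₂ - k₁`
(`Trajectory.high_decay_of_eq`).

A weak solution is identified with the flow by truncating in frequency, where the generator is
bounded (`IsSolution.fourier_eq_flow`). At low frequency the transform of `U₀` is bounded by its
`L¹` norm, and the `L²` norm of `|ω| ^ j * exp (-c ω ^ 4 (1 + t))` scales like `(1 + t) ^ (-1/8 -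
j/4)`. At high frequency `exp (-c ω ^ (-4) t)` is at most a multiple of `(1 + t) ^ (-l/4) * |ω| ^
l`: the time decay is paid for with `l` derivatives of the data. -/

noncomputable section

namespace LaminatedBeam

/-! ### Abstract Lyapunov method, uniform over a family of energies -/

section Absorption

variable {ι : Type*}

/-- A family of functions of time is absorbed, relative to the energies `E`, the dissipations `D`
and the weights `W`, if it is bounded by an arbitrarily small multiple of `W`, a multiple of `D`
and the derivative of a function controlled by `E`. -/
def Absorbed (S : Set ι) (E D W : ι → ℝ → ℝ) (Q : ι → ℝ → ℝ) : Prop :=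
  ∀ ε > 0, ∃ C ≥ 0, ∀ i ∈ S, ∃ G G' : ℝ → ℝ, (∀ t, HasDerivAt G (G' t) t) ∧
    (∀ t, |G t| ≤ C * E i t) ∧ ∀ t, Q i t ≤ ε * W i t + C * D i t + G' t

/-- The square of `b` is dominated by a multiple of `W`. -/
def SqDominated (S : Set ι) (W : ι → ℝ → ℝ) (b : ι → ℝ → ℝ) : Prop :=
  ∃ K ≥ 0, ∀ i ∈ S, ∀ t, b i t ^ 2 ≤ K * W i t

variable {S : Set ι} {E D W Q R : ι → ℝ → ℝ}

lemma Absorbed.add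
    (hQ : Absorbed S E D W Q) (hR : Absorbed S E D W R) :
    Absorbed S E D W (fun i t => Q i t + R i t) := by
  intro ε hε
  obtain ⟨C₁, hC₁, h₁⟩ := hQ (ε / 2) (by positivity)
  obtain ⟨C₂, hC₂, h₂⟩ := hR (ε / 2) (by positivity)
  refine ⟨C₁ + C₂, by positivity, fun i hi => ?_⟩
  obtain ⟨G₁, G₁', hd₁, hb₁, hq₁⟩ := h₁ i hi
  obtain ⟨G₂, G₂', hd₂, hb₂, hq₂⟩ := h₂ i hi
  refine ⟨fun t => G₁ t + G₂ t, fun t => G₁' t + G₂' t, fun t => (hd₁ t).add (hd₂ t),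
    fun t => ?_, fun t => ?_⟩
  · linarith [abs_add_le (G₁ t) (G₂ t), hb₁ t, hb₂ t]
  · linarith [hq₁ t, hq₂ t]

lemma Absorbed.of_mul_le {k : ℝ} (hk : 0 < k) (hQ : Absorbed S E D W Q)
    (h : ∀ i ∈ S, ∀ t, k * R i t ≤ Q i t) : Absorbed S E D W R := by
  intro ε hε
  obtain ⟨C, hC, h₁⟩ := hQ (k * ε) (by positivity)
  refine ⟨k⁻¹ * C, by positivity, fun i hi => ?_⟩
  obtain ⟨G, G', hd, hb, hq⟩ := h₁ i hi
  refine ⟨fun t => k⁻¹ * G t, fun t => k⁻¹ * G' t, fun t => (hd t).const_mul _,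
    fun t => ?_, fun t => ?_⟩
  · rw [abs_mul, abs_of_pos (by positivity : 0 < k⁻¹), mul_assoc]
    exact mul_le_mul_of_nonneg_left (hb t) (by positivity)
  · have : R i t = k⁻¹ * (k * R i t) := by field_simp
    rw [this]
    calc k⁻¹ * (k * R i t) ≤ k⁻¹ * (k * ε * W i t + C * D i t + G' t) := by
          gcongr
          exact (h i hi t).trans (hq t)
      _ = _ := by field_simp

lemma Absorbed.mono (hQ : Absorbed S E D W Q) (h : ∀ i ∈ S, ∀ t, R i t ≤ Q i t) :
    Absorbed S E D W R :=
  hQ.of_mul_le one_pos (by simpa using h)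

lemma Absorbed.const_mul (hW : ∀ i t, 0 ≤ W i t)
    {k : ℝ} (hk : 0 ≤ k) (hQ : Absorbed S E D W Q) :
    Absorbed S E D W (fun i t => k * Q i t) := by
  rcases hk.eq_or_lt with rfl | hk
  · intro ε hε
    refine ⟨0, le_rfl, fun i _ => ⟨fun _ => 0, fun _ => 0, fun t => hasDerivAt_const _ _,
      fun t => by simp, fun t => ?_⟩⟩
    have := hW i t
    simp only [zero_mul, add_zero]
    positivity
  · exact hQ.of_mul_le (inv_pos.2 hk) fun i _ t => by field_simp; exact le_rfl

lemma Absorbed.dissipation (hE : ∀ i t, 0 ≤ E i t) (hW : ∀ i t, 0 ≤ W i t) :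
    Absorbed S E D W D := by
  intro ε hε
  refine ⟨1, zero_le_one, fun i _ => ⟨fun _ => 0, fun _ => 0, fun t => hasDerivAt_const _ _,
      fun t => by simpa using hE i t, fun t => ?_⟩⟩
  have := mul_nonneg hε.le (hW i t)
  linarith

/-- Young's inequality: control of one factor is enough, because the other enters with a coefficient
as small as desired. -/
lemma Absorbed.cross (hW : ∀ i t, 0 ≤ W i t) {a b : ι → ℝ → ℝ}
    (ha : Absorbed S E D W (fun i t => a i t ^ 2)) (hb : SqDominated S W b) :
    Absorbed S E D W (fun i t => a i t * b i t) := by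
  intro ε hε
  obtain ⟨K, hK, hb⟩ := hb
  have hK' : 0 < K + 1 := by linarith
  -- Using `K + 1` instead of `K` keeps `δ` meaningful when `K = 0`.
  set δ := ε / (K + 1) with hδ
  have hδ0 : 0 < δ := by positivity
  have hδε : δ * (K + 1) = ε := by rw [hδ]; field_simp
  obtain ⟨C, hC, h⟩ := ha.of_mul_le (R := fun i t => a i t ^ 2 / (2 * δ)) (k := 2 * δ)
    (by positivity) (fun i _ t => by field_simp; exact le_rfl) (ε / 2) (by positivity)
  refine ⟨C, hC, fun i hi => ?_⟩
  obtain ⟨G, G', hd, hG, hq⟩ := h i hi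
  refine ⟨G, G', hd, hG, fun t => ?_⟩
  have h1 : a i t * b i t ≤ a i t ^ 2 / (2 * δ) + δ / 2 * b i t ^ 2 := by
    have : 0 ≤ (a i t - δ * b i t) ^ 2 / (2 * δ) := by positivity
    have h2 : (a i t - δ * b i t) ^ 2 / (2 * δ)
      = a i t ^ 2 / (2 * δ) + δ / 2 * b i t ^ 2 - a i t * b i t := by
      field_simp; ring
    linarith
  have h2 : δ / 2 * b i t ^ 2 ≤ ε / 2 * W i t := by
    calc δ / 2 * b i t ^ 2 ≤ δ / 2 * ((K + 1) * W i t) := by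
          gcongr
          have := hb i hi t
          have := hW i t
          nlinarith
      _ = _ := by rw [← hδε]; ring
  have := hq t
  linarith

/-- A total derivative costs nothing: it is itself the term `G'`, and the product being
differentiated is bounded by the energy. -/
lemma Absorbed.exact_mul {c : ι → ℝ} {K : ℝ} (hc : ∀ i ∈ S, |c i| ≤ K)
    {f f' g g' : ι → ℝ → ℝ} (hf : ∀ i t, HasDerivAt (f i) (f' i t) t)
    (hg : ∀ i t, HasDerivAt (g i) (g' i t) t)
    (hfE : ∀ i t, f i t ^ 2 ≤ E i t) (hgE : ∀ i t, g i t ^ 2 ≤ E i t)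
    (hD : ∀ i t, 0 ≤ D i t) (hW : ∀ i t, 0 ≤ W i t) :
    Absorbed S E D W (fun i t => c i * (f' i t * g i t + f i t * g' i t)) := by
  intro ε hε
  refine ⟨|K|, abs_nonneg _, fun i hi => ⟨fun t => c i * (f i t * g i t), _,
    fun t => ((hf i t).mul (hg i t)).const_mul _, fun t => ?_, fun t => ?_⟩⟩
  · rw [abs_mul]
    have h1 : |f i t * g i t| ≤ E i t := by
      have h1 := hfE i t
      have h2 := hgE i t
      rw [abs_le]
      constructor <;> nlinarith [sq_nonneg (f i t + g i t), sq_nonneg (f i t - g i t)]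
    exact mul_le_mul ((hc i hi).trans (le_abs_self K)) h1 (abs_nonneg _) (abs_nonneg _)
  · have := hW i t
    have := hD i t
    have : 0 ≤ ε * W i t + |K| * D i t := by positivity
    simpa using this

lemma SqDominated.add {b c : ι → ℝ → ℝ} (hb : SqDominated S W b)
    (hc : SqDominated S W c) : SqDominated S W (fun i t => b i t + c i t) := by
  obtain ⟨K₁, hK₁, h₁⟩ := hb
  obtain ⟨K₂, hK₂, h₂⟩ := hc
  refine ⟨2 * K₁ + 2 * K₂, by positivity, fun i hi t => ?_⟩
  nlinarith [h₁ i hi t, h₂ i hi t, sq_nonneg (b i t - c i t)]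

lemma SqDominated.bdd_mul {b : ι → ℝ → ℝ} (hb : SqDominated S W b) {c : ι → ℝ} {K : ℝ}
    (hc : ∀ i ∈ S, |c i| ≤ K) : SqDominated S W (fun i t => c i * b i t) := by
  obtain ⟨K₁, hK₁, h₁⟩ := hb
  refine ⟨K ^ 2 * K₁, by positivity, fun i hi t => ?_⟩
  rw [mul_pow, mul_assoc]
  have : c i ^ 2 ≤ K ^ 2 := sq_le_sq' (by linarith [abs_le.1 (hc i hi)]) (abs_le.1 (hc i hi)).2
  exact mul_le_mul this (h₁ i hi t) (sq_nonneg _) (sq_nonneg _)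

/-- If the weight itself is absorbed and dominates `f` times the energy, then the energy decays
exponentially at a rate proportional to `f`. -/
lemma Absorbed.decay (hE : ∀ i t, 0 ≤ E i t) (hD : ∀ i t, 0 ≤ D i t)
    {N : ι → ℝ → ℝ} {m M d : ℝ} (hm : 0 < m) (hd : 0 < d)
    (hN₁ : ∀ i t, m * E i t ≤ N i t) (hN₂ : ∀ i t, N i t ≤ M * E i t)
    (hN' : ∀ i t, HasDerivAt (N i) (-d * D i t) t)
    {f : ι → ℝ} (hf : ∀ i ∈ S, 0 ≤ f i) (hW : ∀ i ∈ S, ∀ t, f i * E i t ≤ W i t)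
    (h : Absorbed S E D W W) :
    ∃ C c : ℝ, 0 < C ∧ 0 < c ∧ ∀ i ∈ S, ∀ t, 0 ≤ t →
      E i t ≤ C * Real.exp (-(c * f i * t)) * E i 0 := by
  obtain ⟨C, hC, h⟩ := h (1 / 2) (by norm_num)
  -- The Lyapunov functional is `A * N - G`. The bound `C ≤ A * d` lets the decay of `A * N` absorb
  -- the term `C * D`; the bound `C + 1 ≤ A * m` keeps the functional above `E`.
  obtain ⟨A, hA₁, hA₂, hA₃⟩ : ∃ A : ℝ, 0 < A ∧ C ≤ A * d ∧ C + 1 ≤ A * m := by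
    refine ⟨(C + 1) / d + (C + 1) / m, by positivity, ?_, ?_⟩
    · rw [add_mul, div_mul_cancel₀ _ hd.ne']
      have : 0 ≤ (C + 1) / m * d := by positivity
      linarith
    · rw [add_mul, div_mul_cancel₀ _ hm.ne']
      have : 0 ≤ (C + 1) / d * m := by positivity
      linarith
  set B := A * |M| + C + 1 with hB
  have hB0 : 0 < B := by positivity
  refine ⟨B, 1 / (2 * B), hB0, by positivity, fun i hi => ?_⟩
  obtain ⟨G, G', hG, hGE, hq⟩ := h i hi
  have low : ∀ t, E i t ≤ A * N i t - G t := fun t => by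
    have h1 := hN₁ i t
    have h2 := (abs_le.1 (hGE t)).2
    have h3 := hE i t
    nlinarith
  have high : ∀ t, A * N i t - G t ≤ B * E i t := fun t => by
    have h1 := hN₂ i t
    have h2 := (abs_le.1 (hGE t)).1
    have h3 := hE i t
    have h4 : M * E i t ≤ |M| * E i t := by gcongr; exact le_abs_self M
    have h5 : A * N i t ≤ A * (|M| * E i t) := by gcongr; linarith
    rw [hB]
    nlinarith
  set r := 1 / (2 * B) * f i with hr
  have hr0 : 0 ≤ r := mul_nonneg (by positivity) (hf i hi)
  have der : ∀ t, HasDerivAt (fun t => Real.exp (r * t) * (A * N i t - G t))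
      (Real.exp (r * t) * r * (A * N i t - G t)
        + Real.exp (r * t) * (A * (-d * D i t) - G' t)) t := fun t => by
    have h1 : HasDerivAt (fun t => Real.exp (r * t)) (Real.exp (r * t) * r) t := by
      simpa using ((hasDerivAt_id t).const_mul r).exp
    exact h1.mul (((hN' i t).const_mul A).sub (hG t))
  have anti : Antitone (fun t => Real.exp (r * t) * (A * N i t - G t)) := by
    refine antitone_of_hasDerivAt_nonpos der fun t => ?_
    have h1 := hq t
    have h2 := hW i hi t
    have h3 : r * (A * N i t - G t) ≤ 1 / 2 * (f i * E i t) := by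
      calc r * (A * N i t - G t) ≤ r * (B * E i t) := by gcongr; exact high t
        _ = _ := by rw [hr]; field_simp
    -- With `ε = 1 / 2`, half of `W` survives as damping, and it dominates `f * E / 2`, hence `r`
    -- times the functional.
    have h4 : r * (A * N i t - G t) + (A * (-d * D i t) - G' t) ≤ 0 := by
      have := mul_le_mul_of_nonneg_right hA₂ (hD i t)
      nlinarith
    have := mul_nonpos_of_nonneg_of_nonpos (Real.exp_pos (r * t)).le h4
    simp only [Pi.zero_apply]
    linarith
  intro t ht
  have h1 := anti ht
  simp only [mul_zero, Real.exp_zero, one_mul] at h1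
  rw [Real.exp_neg]
  have h2 : Real.exp (r * t) * E i t ≤ B * E i 0 :=
    (mul_le_mul_of_nonneg_left (low t) (Real.exp_pos _).le).trans (h1.trans (high 0))
  have h3 := Real.exp_pos (r * t)
  rw [mul_right_comm, ← div_eq_mul_inv, le_div_iff₀ h3, mul_comm]
  exact h2

end Absorption

/-! ### Real form of the transformed system and its energy balance -/

/-- Solutions of the real form of the Fourier transformed system at the frequency `ω`: the
components `u, z, φ, η` are multiplied by the imaginary unit. -/
structure Trajectory (p : Params) where
  ω : ℝ
  v : ℝ → ℝ
  u : ℝ → ℝ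
  z : ℝ → ℝ
  y : ℝ → ℝ
  φ : ℝ → ℝ
  θ : ℝ → ℝ
  η : ℝ → ℝ
  hv : ∀ t, HasDerivAt v (ω * u t + y t + θ t) t
  hu : ∀ t, HasDerivAt u (-(ω * p.k₁ * v t)) t
  hz : ∀ t, HasDerivAt z (-(ω * y t)) t
  hy : ∀ t, HasDerivAt y (ω * p.k₂ * z t - p.k₁ * v t) t
  hφ : ∀ t, HasDerivAt φ (-(ω * θ t)) t
  hθ : ∀ t, HasDerivAt θ (ω * p.k₃ * φ t - p.k₁ * v t - ω * p.γ * η t) t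
  hη : ∀ t, HasDerivAt η (-(p.k₄ * ω ^ 2 * η t) + ω * p.γ * θ t) t

namespace Trajectory

variable {p : Params}

/-- The squared Euclidean norm of the state. -/
def energy (T : Trajectory p) (t : ℝ) : ℝ :=
  T.v t ^ 2 + T.u t ^ 2 + T.z t ^ 2 + T.y t ^ 2 + T.φ t ^ 2 + T.θ t ^ 2 + T.η t ^ 2

/-- The dissipation, up to the factor `2 k₄`, of the physical energy. -/
def dissipation (T : Trajectory p) (t : ℝ) : ℝ := (T.ω * T.η t) ^ 2

/-- The physical energy. -/
def physicalEnergy (T : Trajectory p) (t : ℝ) : ℝ :=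
  p.k₁ * T.v t ^ 2 + T.u t ^ 2 + p.k₂ * T.z t ^ 2 + T.y t ^ 2 + p.k₃ * T.φ t ^ 2 + T.θ t ^ 2
    + T.η t ^ 2

/-- The weight at low frequencies. -/
def lowWeight (T : Trajectory p) (t : ℝ) : ℝ := T.ω ^ 4 * T.energy t

/-- The weight at high frequencies for arbitrary wave speeds. -/
def highWeight (T : Trajectory p) (t : ℝ) : ℝ :=
  T.θ t ^ 2 + T.φ t ^ 2 + T.η t ^ 2 + (T.ω⁻¹ * T.v t) ^ 2 + (T.ω⁻¹ * T.u t) ^ 2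
    + (T.ω⁻¹ ^ 2 * T.y t) ^ 2 + (T.ω⁻¹ ^ 2 * T.z t) ^ 2

lemma energy_nonneg (T : Trajectory p) (t : ℝ) : 0 ≤ T.energy t := by
  unfold energy; positivity

lemma dissipation_nonneg (T : Trajectory p) (t : ℝ) : 0 ≤ T.dissipation t := sq_nonneg _

lemma lowWeight_nonneg (T : Trajectory p) (t : ℝ) : 0 ≤ T.lowWeight t :=
  mul_nonneg (by positivity) (T.energy_nonneg t)

lemma highWeight_nonneg (T : Trajectory p) (t : ℝ) : 0 ≤ T.highWeight t := by
  unfold highWeight; positivity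

/-- The weights `k₁, k₂, k₃` make all coupling terms cancel in pairs, so only the heat conduction
term remains. -/
lemma hasDerivAt_physicalEnergy (T : Trajectory p) (t : ℝ) :
    HasDerivAt T.physicalEnergy (-(2 * p.k₄) * T.dissipation t) t := by
  unfold physicalEnergy dissipation
  have h := (((((((((T.hv t).pow 2).const_mul p.k₁).add ((T.hu t).pow 2)).add
    (((T.hz t).pow 2).const_mul p.k₂)).add ((T.hy t).pow 2)).add
    (((T.hφ t).pow 2).const_mul p.k₃)).add ((T.hθ t).pow 2)).add ((T.hη t).pow 2))
  refine (h.congr_deriv ?_)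
  push_cast
  ring

lemma exists_physicalEnergy_bounds (p : Params) : ∃ m M : ℝ, 0 < m ∧
    (∀ (T : Trajectory p) t, m * T.energy t ≤ T.physicalEnergy t) ∧
    (∀ (T : Trajectory p) t, T.physicalEnergy t ≤ M * T.energy t) := by
  obtain ⟨k₁, k₂, k₃, k₄, γ, h₁, h₂, h₃, h₄, hγ⟩ := p
  refine ⟨min 1 (min k₁ (min k₂ k₃)), 1 + k₁ + k₂ + k₃, by positivity, fun T t => ?_,
    fun T t => ?_⟩
  · set m := min 1 (min k₁ (min k₂ k₃))
    have a1 : m ≤ 1 := min_le_left _ _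
    have a2 : m ≤ k₁ := (min_le_right _ _).trans (min_le_left _ _)
    have a3 : m ≤ k₂ := (min_le_right _ _).trans ((min_le_right _ _).trans (min_le_left _ _))
    have a4 : m ≤ k₃ := (min_le_right _ _).trans ((min_le_right _ _).trans (min_le_right _ _))
    simp only [energy, physicalEnergy, mul_add]
    gcongr <;> nlinarith [sq_nonneg (T.u t), sq_nonneg (T.y t), sq_nonneg (T.θ t),
      sq_nonneg (T.η t)]
  · simp only [energy, physicalEnergy, mul_add]
    gcongr ?_ + ?_ + ?_ + ?_ + ?_ + ?_ + ?_
    · gcongr; linarith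
    · nlinarith [sq_nonneg (T.u t)]
    · gcongr; linarith
    · nlinarith [sq_nonneg (T.y t)]
    · gcongr; linarith
    · nlinarith [sq_nonneg (T.θ t)]
    · nlinarith [sq_nonneg (T.η t)]

/-- Absorption for trajectories. -/
abbrev Negligible (S : Set (Trajectory p)) (W Q : Trajectory p → ℝ → ℝ) : Prop :=
  Absorbed S energy dissipation W Q

lemma sq_le_energy (T : Trajectory p) (t : ℝ) :
    T.v t ^ 2 ≤ T.energy t ∧ T.u t ^ 2 ≤ T.energy t ∧ T.z t ^ 2 ≤ T.energy t ∧
    T.y t ^ 2 ≤ T.energy t ∧ T.φ t ^ 2 ≤ T.energy t ∧ T.θ t ^ 2 ≤ T.energy t ∧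
    T.η t ^ 2 ≤ T.energy t := by
  unfold energy
  refine ⟨?_, ?_, ?_, ?_, ?_, ?_, ?_⟩ <;>
  linarith [sq_nonneg (T.v t), sq_nonneg (T.u t), sq_nonneg (T.z t), sq_nonneg (T.y t),
    sq_nonneg (T.φ t), sq_nonneg (T.θ t), sq_nonneg (T.η t)]

variable {S : Set (Trajectory p)} {W : Trajectory p → ℝ → ℝ}

/-- The derivative of a product of two components is negligible. -/
lemma negligible_exact (hW : ∀ T t, 0 ≤ W T t) (c : Trajectory p → ℝ) (K : ℝ)
    (hc : ∀ T ∈ S, |c T| ≤ K) {f f' g g' : Trajectory p → ℝ → ℝ}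
    (hf : ∀ T t, HasDerivAt (f T) (f' T t) t ∧ f T t ^ 2 ≤ T.energy t)
    (hg : ∀ T t, HasDerivAt (g T) (g' T t) t ∧ g T t ^ 2 ≤ T.energy t) :
    Negligible S W (fun T t => c T * (f' T t * g T t + f T t * g' T t)) :=
  Absorbed.exact_mul hc (fun T t => (hf T t).1) (fun T t => (hg T t).1)
    (fun T t => (hf T t).2) (fun T t => (hg T t).2) dissipation_nonneg hW

lemma cv (T : Trajectory p) (t : ℝ) :
    HasDerivAt T.v (T.ω * T.u t + T.y t + T.θ t) t ∧ T.v t ^ 2 ≤ T.energy t :=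
  ⟨T.hv t, (T.sq_le_energy t).1⟩

lemma cu (T : Trajectory p) (t : ℝ) :
    HasDerivAt T.u (-(T.ω * p.k₁ * T.v t)) t ∧ T.u t ^ 2 ≤ T.energy t :=
  ⟨T.hu t, (T.sq_le_energy t).2.1⟩

lemma cz (T : Trajectory p) (t : ℝ) :
    HasDerivAt T.z (-(T.ω * T.y t)) t ∧ T.z t ^ 2 ≤ T.energy t :=
  ⟨T.hz t, (T.sq_le_energy t).2.2.1⟩

lemma cy (T : Trajectory p) (t : ℝ) :
    HasDerivAt T.y (T.ω * p.k₂ * T.z t - p.k₁ * T.v t) t ∧ T.y t ^ 2 ≤ T.energy t :=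
  ⟨T.hy t, (T.sq_le_energy t).2.2.2.1⟩

lemma cφ (T : Trajectory p) (t : ℝ) :
    HasDerivAt T.φ (-(T.ω * T.θ t)) t ∧ T.φ t ^ 2 ≤ T.energy t :=
  ⟨T.hφ t, (T.sq_le_energy t).2.2.2.2.1⟩

lemma cθ (T : Trajectory p) (t : ℝ) :
    HasDerivAt T.θ (T.ω * p.k₃ * T.φ t - p.k₁ * T.v t - T.ω * p.γ * T.η t) t ∧
      T.θ t ^ 2 ≤ T.energy t :=
  ⟨T.hθ t, (T.sq_le_energy t).2.2.2.2.2.1⟩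

lemma cη (T : Trajectory p) (t : ℝ) :
    HasDerivAt T.η (-(p.k₄ * T.ω ^ 2 * T.η t) + T.ω * p.γ * T.θ t) t ∧
      T.η t ^ 2 ≤ T.energy t :=
  ⟨T.hη t, (T.sq_le_energy t).2.2.2.2.2.2⟩

end Trajectory

open Trajectory

lemma abs_const_mul_pow_le {x : ℝ} (hx : |x| ≤ 1) (c : ℝ) (n : ℕ) : |c * x ^ n| ≤ |c| := by
  rw [abs_mul, abs_pow]
  exact mul_le_of_le_one_right (abs_nonneg _) (pow_le_one₀ (abs_nonneg _) hx)

lemma abs_pow_le_one {x : ℝ} (hx : |x| ≤ 1) (n : ℕ) : |x ^ n| ≤ 1 := by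
  rw [abs_pow]; exact pow_le_one₀ (abs_nonneg _) hx

/-! ### Decay at low frequencies -/

section LowFrequency

variable {p : Params}

/-- A component carrying at least two powers of `ω` may serve as the free factor in
`Absorbed.cross`; further powers are harmless for `|ω| ≤ 1`. -/
lemma sqDominated_low {f : Trajectory p → ℝ → ℝ} (hf : ∀ T t, f T t ^ 2 ≤ T.energy t)
    (c : ℝ) (n : ℕ) :
    SqDominated {T : Trajectory p | |T.ω| ≤ 1} lowWeight
      (fun T t => c * T.ω ^ n * (T.ω ^ 2 * f T t)) := by
  have h : SqDominated {T : Trajectory p | |T.ω| ≤ 1} lowWeight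
      (fun T t => T.ω ^ 2 * f T t) := by
    refine ⟨1, zero_le_one, fun T _ t => ?_⟩
    rw [lowWeight, one_mul, mul_pow]
    calc (T.ω ^ 2) ^ 2 * f T t ^ 2 ≤ (T.ω ^ 2) ^ 2 * T.energy t := by gcongr; exact hf T t
      _ = _ := by ring
  exact h.bdd_mul (fun T hT => abs_const_mul_pow_le hT c n)

/-- At low frequencies the energy decays at the rate `ω ^ 4`. -/
theorem Trajectory.low_decay (p : Params) : ∃ C c : ℝ, 0 < C ∧ 0 < c ∧ ∀ T : Trajectory p,
    |T.ω| ≤ 1 → ∀ t, 0 ≤ t → T.energy t ≤ C * Real.exp (-(c * T.ω ^ 4 * t)) * T.energy 0 := by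
  set S := {T : Trajectory p | |T.ω| ≤ 1} with hS
  have hk₁ := p.hk₁
  have hk₂ := p.hk₂
  have hk₃ := p.hk₃
  have hγ := p.hγ
  have hW := lowWeight_nonneg (p := p)
  have one : ∀ (c : ℝ) (n : ℕ), ∀ T ∈ S, |c * T.ω ^ n| ≤ |c| :=
    fun c n T hT => abs_const_mul_pow_le hT c n
  have ex := fun (c : ℝ) (n : ℕ) {f f' g g' : Trajectory p → ℝ → ℝ} =>
    negligible_exact (f := f) (f' := f') (g := g) (g' := g') hW (fun T => c * T.ω ^ n) |c| (one c n)
  have dv := sqDominated_low (fun T t => (cv (p := p) T t).2)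
  have du := sqDominated_low (fun T t => (cu (p := p) T t).2)
  have dz := sqDominated_low (fun T t => (cz (p := p) T t).2)
  have dy := sqDominated_low (fun T t => (cy (p := p) T t).2)
  have dφ := sqDominated_low (fun T t => (cφ (p := p) T t).2)
  have dθ := sqDominated_low (fun T t => (cθ (p := p) T t).2)
  have dη := sqDominated_low (fun T t => (cη (p := p) T t).2)
  have Nη : Negligible S lowWeight (fun T t => (T.ω * T.η t) ^ 2) :=
    Absorbed.dissipation energy_nonneg hW
  have Nθ : Negligible S lowWeight (fun T t => (T.ω ^ 2 * T.θ t) ^ 2) := by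
    refine ((ex 1 3 cθ cη).add (Nη.cross hW ((((dθ p.k₄ 2).add (dφ (-p.k₃) 1)).add
      (dv p.k₁ 0)).add (dη p.γ 1)))).of_mul_le hγ fun T _ t => le_of_eq ?_
    ring
  -- In `(η u)' + γ (φ u)'` the terms `ω γ θ u` cancel. The product `φ v` is thus bounded with its
  -- sign before either factor is.
  have Nφv : Negligible S lowWeight (fun T t => T.ω ^ 3 * T.φ t * T.v t) := by
    refine (((ex (-1) 2 cη cu).add (ex (-p.γ) 2 cφ cu)).add (Nη.cross hW
      ((du (-p.k₄) 1).add (dv (-p.k₁) 0)))).of_mul_le (mul_pos hk₁ hγ) fun T _ t => le_of_eq ?_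
    ring
  have Nφ : Negligible S lowWeight (fun T t => (T.ω ^ 2 * T.φ t) ^ 2) := by
    refine ((((ex 1 3 cθ cφ).add (Nφv.const_mul hW hk₁.le)).add
      (Nη.cross hW (dφ p.γ 1))).add Nθ).of_mul_le hk₃ fun T _ t => le_of_eq ?_
    ring
  have Nv : Negligible S lowWeight (fun T t => (T.ω ^ 2 * T.v t) ^ 2) := by
    refine ((((ex (-1) 4 cθ cv).add (Nθ.cross hW (((du 1 1).add (dy 1 0)).add (dθ 1 0)))).add
      (Nφ.cross hW (dv p.k₃ 1))).add (Nη.cross hW (dv (-p.γ) 2))).of_mul_le hk₁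
      fun T _ t => le_of_eq ?_
    ring
  -- The coefficients `1, 1, 2` cancel the products `u y`, leaving `ω⁶ u² + ω⁴ y²` with a good sign.
  have Ny : Negligible S lowWeight (fun T t => (T.ω ^ 2 * T.y t) ^ 2) := by
    refine (((((ex 1 5 cv cu).add (ex 1 4 cv cy)).add (ex 2 4 cu cz)).add
      ((Nθ.cross hW ((du (-1) 1).add (dy (-1) 0))).add
      (Nv.cross hW (dz (-(p.k₂ - 2 * p.k₁)) 1)))).add
      (Nv.const_mul hW (by positivity : 0 ≤ 2 * p.k₁))).mono fun T hT t => ?_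
    have h1 : T.ω ^ 2 ≤ 1 := by simpa using (abs_le.1 (abs_pow_le_one hT 2)).2
    have h2 : 0 ≤ p.k₁ * (1 - T.ω ^ 2) * (T.ω ^ 2 * T.v t) ^ 2 + (T.ω ^ 3 * T.u t) ^ 2 := by
      have : 0 ≤ 1 - T.ω ^ 2 := by linarith
      positivity
    linarith
  -- Subtracting `(θ z)'` removes `k₁ ω³ v z`, whose factor `ω z` is not dominated by `lowWeight`.
  have Nz : Negligible S lowWeight (fun T t => (T.ω ^ 2 * T.z t) ^ 2) := by
    refine ((((((ex 1 3 cy cz).add (ex (-1) 3 cθ cz)).add (Nφ.cross hW (dz p.k₃ 0))).add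
      (Nη.cross hW (dz (-p.γ) 1))).add Ny).add (Nθ.cross hW (dy (-1) 0))).of_mul_le hk₂
      fun T _ t => le_of_eq ?_
    ring
  -- In `ω³ (u v)'` the terms `u y` and `u θ` lack a power of `ω`. They are cancelled by `(u z)'`
  -- and `(u φ)'`; the resulting `v z` is cancelled by `(y z)'`, and the resulting `φ v` is `Nφv`.
  have Nu : Negligible S lowWeight (fun T t => (T.ω ^ 2 * T.u t) ^ 2) := by
    refine ((((((ex 1 3 cu cv).add (ex 1 2 cu cz)).add (ex 1 2 cu cφ)).add (ex (-1) 3 cy cz)).add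
      ((Nv.const_mul hW hk₁.le).add (Nz.const_mul hW hk₂.le))).add
      (Nφv.const_mul hW hk₁.le)).mono fun T _ t => ?_
    have : 0 ≤ T.ω ^ 4 * T.y t ^ 2 := by positivity
    linarith
  obtain ⟨m, M, hm, hN₁, hN₂⟩ := exists_physicalEnergy_bounds p
  refine Absorbed.decay (S := S) (W := lowWeight) energy_nonneg dissipation_nonneg hm
    (mul_pos two_pos p.hk₄) hN₁ hN₂ hasDerivAt_physicalEnergy (f := fun T => T.ω ^ 4)
    (fun T _ => by positivity) (fun T _ t => le_rfl) ?_
  refine ((((((Nv.add Nu).add Nz).add Ny).add Nφ).add Nθ).add Nη).mono fun T hT t => ?_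
  have h1 : T.ω ^ 2 ≤ 1 := by simpa using (abs_le.1 (abs_pow_le_one hT 2)).2
  have h2 : 0 ≤ (1 - T.ω ^ 2) * (T.ω * T.η t) ^ 2 := by
    have : 0 ≤ 1 - T.ω ^ 2 := by linarith
    positivity
  unfold lowWeight energy
  linarith

end LowFrequency

/-! ### Decay at high frequencies, for arbitrary and for equal wave speeds -/

section HighFrequency

variable {p : Params}

lemma sqDominated_high {S : Set (Trajectory p)} (hS : ∀ T ∈ S, |T.ω⁻¹| ≤ 1)
    {W f : Trajectory p → ℝ → ℝ} (hf : ∀ T ∈ S, ∀ t, f T t ^ 2 ≤ W T t) (c : ℝ) (n : ℕ) :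
    SqDominated S W (fun T t => c * T.ω⁻¹ ^ n * f T t) := by
  have h : SqDominated S W f := ⟨1, zero_le_one, fun T hT t => by simpa using hf T hT t⟩
  exact h.bdd_mul (fun T hT => abs_const_mul_pow_le (hS T hT) c n)

lemma high_negligible_exact {S : Set (Trajectory p)} (hS : ∀ T ∈ S, |T.ω⁻¹| ≤ 1)
    {W : Trajectory p → ℝ → ℝ} (hW : ∀ T t, 0 ≤ W T t) (c : ℝ) (n : ℕ)
    {f f' g g' : Trajectory p → ℝ → ℝ}
    (hf : ∀ T t, HasDerivAt (f T) (f' T t) t ∧ f T t ^ 2 ≤ T.energy t)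
    (hg : ∀ T t, HasDerivAt (g T) (g' T t) t ∧ g T t ^ 2 ≤ T.energy t) :
    Negligible S W (fun T t => c * T.ω⁻¹ ^ n * (f' T t * g T t + f T t * g' T t)) :=
  negligible_exact hW _ |c| (fun T hT => abs_const_mul_pow_le (hS T hT) c n) hf hg

/-- The thermoelastic components are damped at a uniform rate at high frequencies. -/
lemma high_negligible_thermoelastic {S : Set (Trajectory p)}
    (hS₀ : ∀ T ∈ S, T.ω ≠ 0) (hS : ∀ T ∈ S, |T.ω⁻¹| ≤ 1)
    {W : Trajectory p → ℝ → ℝ} (hW : ∀ T t, 0 ≤ W T t)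
    (bv : ∀ T ∈ S, ∀ t, (T.ω⁻¹ * T.v t) ^ 2 ≤ W T t)
    (bu : ∀ T ∈ S, ∀ t, (T.ω⁻¹ * T.u t) ^ 2 ≤ W T t)
    (bφ : ∀ T ∈ S, ∀ t, T.φ t ^ 2 ≤ W T t)
    (bθ : ∀ T ∈ S, ∀ t, T.θ t ^ 2 ≤ W T t)
    (bη : ∀ T ∈ S, ∀ t, T.η t ^ 2 ≤ W T t) :
    Negligible S W (fun T t => T.θ t ^ 2) ∧ Negligible S W (fun T t => T.φ t ^ 2) := by
  have hk₁ := p.hk₁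
  have hk₃ := p.hk₃
  have hγ := p.hγ
  have ex := fun (c : ℝ) (n : ℕ) {f f' g g' : Trajectory p → ℝ → ℝ} =>
    high_negligible_exact (f := f) (f' := f') (g := g) (g' := g') hS hW c n
  have dv := sqDominated_high hS bv
  have du := sqDominated_high hS bu
  have dφ := sqDominated_high hS bφ
  have dθ := sqDominated_high hS bθ
  have dη := sqDominated_high hS bη
  have Nη : Negligible S W (fun T t => (T.ω * T.η t) ^ 2) :=
    Absorbed.dissipation energy_nonneg hW
  have Nθ : Negligible S W (fun T t => T.θ t ^ 2) := by
    refine ((ex 1 1 cθ cη).add (Nη.cross hW ((((dθ p.k₄ 0).add (dφ (-p.k₃) 1)).add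
      (dv p.k₁ 1)).add (dη p.γ 1)))).of_mul_le hγ fun T hT t => le_of_eq ?_
    have := hS₀ T hT
    field_simp
    ring
  have Nφv : Negligible S W (fun T t => T.ω⁻¹ * T.φ t * T.v t) := by
    refine (((ex (-1) 2 cη cu).add (ex (-p.γ) 2 cφ cu)).add (Nη.cross hW
      ((du (-p.k₄) 0).add (dv (-p.k₁) 1)))).of_mul_le (mul_pos hk₁ hγ) fun T hT t => le_of_eq ?_
    have := hS₀ T hT
    field_simp
    ring
  refine ⟨Nθ, ((((ex 1 1 cθ cφ).add (Nφv.const_mul hW hk₁.le)).add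
      (Nη.cross hW (dφ p.γ 1))).add Nθ).of_mul_le hk₃ fun T hT t => le_of_eq ?_⟩
  have := hS₀ T hT
  field_simp
  ring

/-- At high frequencies the energy decays at least at the rate `ω ^ (-4)`. -/
theorem Trajectory.high_decay (p : Params) : ∃ C c : ℝ, 0 < C ∧ 0 < c ∧ ∀ T : Trajectory p,
    1 ≤ |T.ω| → ∀ t, 0 ≤ t →
      T.energy t ≤ C * Real.exp (-(c * T.ω⁻¹ ^ 4 * t)) * T.energy 0 := by
  set S := {T : Trajectory p | 1 ≤ |T.ω|}
  have hS₀ : ∀ T ∈ S, T.ω ≠ 0 := fun T hT h => by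
    have : (1 : ℝ) ≤ |T.ω| := hT
    norm_num [h] at this
  have hS : ∀ T ∈ S, |T.ω⁻¹| ≤ 1 := fun T hT => by rw [abs_inv]; exact inv_le_one_of_one_le₀ hT
  have hk₁ := p.hk₁
  have hk₂ := p.hk₂
  have hW := highWeight_nonneg (p := p)
  have ex := fun (c : ℝ) (n : ℕ) {f f' g g' : Trajectory p → ℝ → ℝ} =>
    high_negligible_exact (f := f) (f' := f') (g := g) (g' := g') hS hW c n
  have b : ∀ (T : Trajectory p) t, (T.ω⁻¹ * T.v t) ^ 2 ≤ T.highWeight t ∧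
      (T.ω⁻¹ * T.u t) ^ 2 ≤ T.highWeight t ∧ (T.ω⁻¹ ^ 2 * T.z t) ^ 2 ≤ T.highWeight t ∧
      (T.ω⁻¹ ^ 2 * T.y t) ^ 2 ≤ T.highWeight t ∧ T.φ t ^ 2 ≤ T.highWeight t ∧
      T.θ t ^ 2 ≤ T.highWeight t ∧ T.η t ^ 2 ≤ T.highWeight t := fun T t => by
    unfold highWeight
    refine ⟨?_, ?_, ?_, ?_, ?_, ?_, ?_⟩ <;>
    linarith [sq_nonneg (T.ω⁻¹ * T.v t), sq_nonneg (T.ω⁻¹ * T.u t), sq_nonneg (T.ω⁻¹ ^ 2 * T.z t),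
      sq_nonneg (T.ω⁻¹ ^ 2 * T.y t), sq_nonneg (T.φ t), sq_nonneg (T.θ t), sq_nonneg (T.η t)]
  have dv := sqDominated_high hS fun T _ t => (b T t).1
  have du := sqDominated_high hS fun T _ t => (b T t).2.1
  have dz := sqDominated_high hS fun T _ t => (b T t).2.2.1
  have dy := sqDominated_high hS fun T _ t => (b T t).2.2.2.1
  have dθ := sqDominated_high hS fun T _ t => (b T t).2.2.2.2.2.1
  have Nη : Negligible S highWeight (fun T t => (T.ω * T.η t) ^ 2) :=
    Absorbed.dissipation energy_nonneg hW
  obtain ⟨Nθ, Nφ⟩ := high_negligible_thermoelastic hS₀ hS hW (fun T _ t => (b T t).1)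
    (fun T _ t => (b T t).2.1) (fun T _ t => (b T t).2.2.2.2.1)
    (fun T _ t => (b T t).2.2.2.2.2.1) (fun T _ t => (b T t).2.2.2.2.2.2)
  -- The terms `ω φ v` and `ω θ u` of `(θ v)'` are not cancelled here, which costs a factor `ω⁻¹` on
  -- `v` and `u`.
  have Nv : Negligible S highWeight (fun T t => (T.ω⁻¹ * T.v t) ^ 2) := by
    refine ((((ex (-1) 2 cθ cv).add (Nθ.cross hW (((du 1 0).add (dy 1 0)).add (dθ 1 2)))).add
      (Nφ.cross hW (dv p.k₃ 0))).add (Nη.cross hW (dv (-p.γ) 1))).of_mul_le hk₁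
      fun T hT t => le_of_eq ?_
    have := hS₀ T hT
    field_simp
    ring
  -- The products `u y` cancel as at low frequency. The surviving `v z`, with coefficient `k₂ - 2
  -- k₁`, forces the factor `ω⁻¹ ^ 2` on `y` and `z`.
  have Nuy : Negligible S highWeight
      (fun T t => (T.ω⁻¹ * T.u t) ^ 2 + (T.ω⁻¹ ^ 2 * T.y t) ^ 2) := by
    refine (((((ex 1 3 cv cu).add (ex 1 4 cv cy)).add (ex 2 4 cu cz)).add
      ((Nθ.cross hW ((du (-1) 2).add (dy (-1) 2))).add
      (Nv.cross hW (dz (-(p.k₂ - 2 * p.k₁)) 0)))).add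
      (Nv.const_mul hW (by positivity : 0 ≤ 2 * p.k₁))).mono fun T hT t => ?_
    have h1 : T.ω⁻¹ ^ 2 ≤ 1 := by simpa using (abs_le.1 (abs_pow_le_one (hS T hT) 2)).2
    have h2 : 0 ≤ p.k₁ * (1 - T.ω⁻¹ ^ 2) * (T.ω⁻¹ * T.v t) ^ 2 := by
      have : 0 ≤ 1 - T.ω⁻¹ ^ 2 := by linarith
      positivity
    refine (le_add_of_nonneg_right h2).trans_eq ?_
    have := hS₀ T hT
    field_simp
    ring
  have Nz : Negligible S highWeight (fun T t => (T.ω⁻¹ ^ 2 * T.z t) ^ 2) := by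
    refine (((ex 1 5 cy cz).add Nuy).add (Nv.cross hW (dz p.k₁ 2))).of_mul_le hk₂
      fun T hT t => ?_
    refine (le_add_of_nonneg_right (sq_nonneg (T.ω⁻¹ * T.u t))).trans_eq ?_
    have := hS₀ T hT
    field_simp
    ring
  obtain ⟨m, M, hm, hN₁, hN₂⟩ := exists_physicalEnergy_bounds p
  refine Absorbed.decay (S := S) (W := highWeight) energy_nonneg dissipation_nonneg hm
    (mul_pos two_pos p.hk₄) hN₁ hN₂ hasDerivAt_physicalEnergy (f := fun T => T.ω⁻¹ ^ 4)
    (fun T _ => by positivity) (fun T hT t => ?_) ?_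
  · have h1 : T.ω⁻¹ ^ 2 ≤ 1 := by simpa using (abs_le.1 (abs_pow_le_one (hS T hT) 2)).2
    have h2 : T.ω⁻¹ ^ 4 ≤ 1 := by simpa using (abs_le.1 (abs_pow_le_one (hS T hT) 4)).2
    have h3 : T.ω⁻¹ ^ 4 ≤ T.ω⁻¹ ^ 2 := by nlinarith [sq_nonneg (T.ω⁻¹)]
    simp only [energy, highWeight, mul_add, mul_pow, ← pow_mul]
    have e : ∀ x : ℝ, T.ω⁻¹ ^ 4 * x ^ 2 ≤ x ^ 2 := fun x =>
      mul_le_of_le_one_left (sq_nonneg x) h2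
    have e' : ∀ x : ℝ, T.ω⁻¹ ^ 4 * x ^ 2 ≤ T.ω⁻¹ ^ 2 * x ^ 2 := fun x =>
      mul_le_mul_of_nonneg_right h3 (sq_nonneg x)
    linarith [e (T.φ t), e (T.θ t), e (T.η t), e' (T.v t), e' (T.u t)]
  · refine ((((Nv.add Nuy).add Nz).add Nφ).add (Nθ.add Nη)).mono fun T hT t => ?_
    have h1 : T.η t ^ 2 ≤ (T.ω * T.η t) ^ 2 := by
      have : (1 : ℝ) ≤ T.ω ^ 2 := by
        rw [← sq_abs]; exact one_le_pow₀ hT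
      nlinarith [sq_nonneg (T.η t)]
    unfold highWeight
    linarith

/-- At high frequencies and for equal wave speeds the energy decays at a uniform rate. -/
theorem Trajectory.high_decay_of_eq (p : Params) (h₁₂ : p.k₁ = p.k₂) (h₂₃ : p.k₂ = p.k₃) :
    ∃ C c : ℝ, 0 < C ∧ 0 < c ∧ ∀ T : Trajectory p,
    1 ≤ |T.ω| → ∀ t, 0 ≤ t → T.energy t ≤ C * Real.exp (-(c * t)) * T.energy 0 := by
  set S := {T : Trajectory p | 1 ≤ |T.ω|}
  have hS₀ : ∀ T ∈ S, T.ω ≠ 0 := fun T hT h => by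
    have : (1 : ℝ) ≤ |T.ω| := hT
    norm_num [h] at this
  have hS : ∀ T ∈ S, |T.ω⁻¹| ≤ 1 := fun T hT => by rw [abs_inv]; exact inv_le_one_of_one_le₀ hT
  have hk₁ := p.hk₁
  have hW := energy_nonneg (p := p)
  have ex := fun (c : ℝ) (n : ℕ) {f f' g g' : Trajectory p → ℝ → ℝ} =>
    high_negligible_exact (f := f) (f' := f') (g := g) (g' := g') hS hW c n
  have dv := sqDominated_high hS fun T _ t => (cv T t).2
  have du := sqDominated_high hS fun T _ t => (cu T t).2
  have dz := sqDominated_high hS fun T _ t => (cz T t).2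
  have dy := sqDominated_high hS fun T _ t => (cy T t).2
  have dθ := sqDominated_high hS fun T _ t => (cθ T t).2
  have Nη : Negligible S energy (fun T t => (T.ω * T.η t) ^ 2) :=
    Absorbed.dissipation energy_nonneg hW
  have scaled : ∀ T ∈ S, ∀ x e : ℝ, x ^ 2 ≤ e → (T.ω⁻¹ * x) ^ 2 ≤ e := fun T hT x e h => by
    have h1 : T.ω⁻¹ ^ 2 ≤ 1 := by simpa using (abs_le.1 (abs_pow_le_one (hS T hT) 2)).2
    rw [mul_pow]
    exact (mul_le_of_le_one_left (sq_nonneg x) h1).trans h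
  obtain ⟨Nθ, Nφ⟩ := high_negligible_thermoelastic hS₀ hS hW
    (fun T hT t => scaled T hT _ _ (cv T t).2) (fun T hT t => scaled T hT _ _ (cu T t).2)
    (fun T _ t => (cφ T t).2) (fun T _ t => (cθ T t).2) (fun T _ t => (cη T t).2)
  -- Adding `(φ u)'` to `(θ v)'` cancels `ω θ u` and leaves `ω (k₃ - k₁) φ v`, which vanishes: no
  -- power of `ω` is lost.
  have Nv : Negligible S energy (fun T t => T.v t ^ 2) := by
    refine ((((ex (-1) 0 cθ cv).add (ex (-1) 0 cφ cu)).add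
      (Nθ.cross hW ((dy 1 0).add (dθ 1 0)))).add (Nη.cross hW (dv (-p.γ) 0))).of_mul_le hk₁
      fun T _ t => le_of_eq ?_
    rw [← h₂₃, ← h₁₂]
    ring
  -- In `(v y)' + (u z)'` the products `u y` cancel and `v z` has the vanishing coefficient `ω (k₂ -
  -- k₁)`.
  have Ny : Negligible S energy (fun T t => T.y t ^ 2) := by
    refine ((((ex 1 0 cv cy).add (ex 1 0 cu cz)).add (Nθ.cross hW (dy (-1) 0))).add
      (Nv.const_mul hW hk₁.le)).mono fun T _ t => le_of_eq ?_
    rw [← h₁₂]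
    ring
  have Nu : Negligible S energy (fun T t => T.u t ^ 2) := by
    refine ((((ex 1 1 cu cv).add (Ny.cross hW (du (-1) 1))).add (Nθ.cross hW (du (-1) 1))).add
      (Nv.const_mul hW hk₁.le)).mono fun T hT t => le_of_eq ?_
    have := hS₀ T hT
    field_simp
    ring
  have Nz : Negligible S energy (fun T t => T.z t ^ 2) := by
    refine (((ex 1 1 cy cz).add Ny).add (Nv.cross hW (dz p.k₁ 1))).of_mul_le p.hk₂
      fun T hT t => le_of_eq ?_
    have := hS₀ T hT
    field_simp
    ring
  obtain ⟨m, M, hm, hN₁, hN₂⟩ := exists_physicalEnergy_bounds p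
  have := Absorbed.decay (S := S) (W := energy) energy_nonneg dissipation_nonneg hm
    (mul_pos two_pos p.hk₄) hN₁ hN₂ hasDerivAt_physicalEnergy (f := fun T => 1)
    (fun T _ => zero_le_one) (fun T hT t => (one_mul _).le) ?_
  · simpa [S] using this
  · refine (((((Nv.add Nu).add Nz).add Ny).add Nφ).add (Nθ.add Nη)).mono fun T hT t => ?_
    have h1 : T.η t ^ 2 ≤ (T.ω * T.η t) ^ 2 := by
      have : (1 : ℝ) ≤ T.ω ^ 2 := by
        rw [← sq_abs]; exact one_le_pow₀ hT
      nlinarith [sq_nonneg (T.η t)]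
    unfold energy
    linarith

end HighFrequency

/-! ### From real trajectories to the complex flow -/

section Symbol

/-- The Fourier symbol of the generator, at the frequency `ω`. -/
def symbol (p : Params) (ω : ℝ) : State →L[ℂ] State :=
  -((Complex.I * ω) ^ 2 • Matrix.toEuclideanCLM (𝕜 := ℂ) (A₂ p)
    + (Complex.I * ω) • Matrix.toEuclideanCLM (𝕜 := ℂ) (A₁ p 0 0 1)
    + Matrix.toEuclideanCLM (𝕜 := ℂ) (A₀ p))

/-- The solution of the Fourier transformed system. -/
def flow (p : Params) (ω t : ℝ) (x : State) : State :=
  NormedSpace.exp (t • symbol p ω) x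

lemma hasDerivAt_flow (p : Params) (ω t : ℝ) (x : State) :
    HasDerivAt (fun t => flow p ω t x) (symbol p ω (flow p ω t x)) t := by
  exact ((ContinuousLinearMap.apply ℂ State x).restrictScalars ℝ).hasFDerivAt.comp_hasDerivAt t
    (hasDerivAt_exp_smul_const' (𝕂 := ℝ) (symbol p ω) t)

lemma flow_zero (p : Params) (ω : ℝ) (x : State) : flow p ω 0 x = x := by
  rw [flow, zero_smul ℝ (symbol p ω), NormedSpace.exp_zero, one_apply_eq_self]

lemma symbol_apply (p : Params) (ω : ℝ) (x : State) :
    symbol p ω x 0 = Complex.I * ω * x 1 + x 3 + x 5 ∧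
    symbol p ω x 1 = Complex.I * ω * p.k₁ * x 0 ∧
    symbol p ω x 2 = Complex.I * ω * x 3 ∧
    symbol p ω x 3 = Complex.I * ω * p.k₂ * x 2 - p.k₁ * x 0 ∧
    symbol p ω x 4 = Complex.I * ω * x 5 ∧
    symbol p ω x 5 = Complex.I * ω * p.k₃ * x 4 - p.k₁ * x 0 - Complex.I * ω * p.γ * x 6 ∧
    symbol p ω x 6 = - (p.k₄ * ω ^ 2 * x 6) - Complex.I * ω * p.γ * x 5 := by
  have h : ∀ M : Matrix (Fin 7) (Fin 7) ℂ, ∀ i,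
      (Matrix.toEuclideanCLM (𝕜 := ℂ) M x) i = ∑ j, M i j * x j := fun M i => rfl
  refine ⟨?_, ?_, ?_, ?_, ?_, ?_, ?_⟩ <;>
  · simp [symbol, h, A₂, A₁, A₀, Fin.sum_univ_succ, mul_pow, Fin.succ] <;> ring

/-- The trajectory obtained from a real linear functional of the complex solution. -/
def flowTrajectory (p : Params) (ω : ℝ) (x : State) (c : ℂ) : Trajectory p :=
  have key : ∀ (b : ℂ) (i : Fin 7) (t : ℝ), HasDerivAt (fun t => (b * flow p ω t x i).re)
      (b * symbol p ω (flow p ω t x) i).re t := fun b i t => by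
    have h1 := (EuclideanSpace.proj (𝕜 := ℂ) i).restrictScalars ℝ |>.hasFDerivAt
      (x := flow p ω t x) |>.comp_hasDerivAt t (hasDerivAt_flow p ω t x)
    exact (Complex.reCLM.hasFDerivAt.comp_hasDerivAt t (h1.const_mul b))
  { ω := ω
    v := fun t => (c * flow p ω t x 0).re
    u := fun t => (c * Complex.I * flow p ω t x 1).re
    z := fun t => (c * Complex.I * flow p ω t x 2).re
    y := fun t => (c * flow p ω t x 3).re
    φ := fun t => (c * Complex.I * flow p ω t x 4).re
    θ := fun t => (c * flow p ω t x 5).re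
    η := fun t => (c * Complex.I * flow p ω t x 6).re
    hv := fun t => (key c 0 t).congr_deriv (by
      rw [(symbol_apply p ω _).1]; simp; ring)
    hu := fun t => (key (c * Complex.I) 1 t).congr_deriv (by
      rw [(symbol_apply p ω _).2.1]; simp; ring)
    hz := fun t => (key (c * Complex.I) 2 t).congr_deriv (by
      rw [(symbol_apply p ω _).2.2.1]; simp; ring)
    hy := fun t => (key c 3 t).congr_deriv (by
      rw [(symbol_apply p ω _).2.2.2.1]; simp; ring)
    hφ := fun t => (key (c * Complex.I) 4 t).congr_deriv (by
      rw [(symbol_apply p ω _).2.2.2.2.1]; simp; ring)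
    hθ := fun t => (key c 5 t).congr_deriv (by
      rw [(symbol_apply p ω _).2.2.2.2.2.1]; simp; ring)
    hη := fun t => (key (c * Complex.I) 6 t).congr_deriv (by
      rw [(symbol_apply p ω _).2.2.2.2.2.2]; simp [pow_two]; ring) }

/-- The choices `c = 1` and `c = I` recover, up to sign, the real and imaginary parts of every
component. -/
lemma norm_flow_sq (p : Params) (ω t : ℝ) (x : State) :
    ‖flow p ω t x‖ ^ 2 = (flowTrajectory p ω x 1).energy t
      + (flowTrajectory p ω x Complex.I).energy t := by
  rw [EuclideanSpace.norm_sq_eq]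
  simp [Trajectory.energy, flowTrajectory, Fin.sum_univ_succ, Complex.sq_norm,
    Complex.normSq_apply, Fin.succ]
  ring

lemma norm_flow_le_of_energy_decay {p : Params} {C r ω t : ℝ}
    (h : ∀ T : Trajectory p, T.ω = ω → T.energy t ≤ C ^ 2 * Real.exp (-(2 * r)) * T.energy 0)
    (hC : 0 ≤ C) (x : State) : ‖flow p ω t x‖ ≤ C * Real.exp (-r) * ‖x‖ := by
  refine le_of_sq_le_sq ?_ (by positivity)
  have h0 := norm_flow_sq p ω 0 x
  rw [flow_zero] at h0
  rw [norm_flow_sq, mul_pow, mul_pow, h0, ← Real.exp_nat_mul]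
  have h1 := h (flowTrajectory p ω x 1) rfl
  have h2 := h (flowTrajectory p ω x Complex.I) rfl
  have e : ((2 : ℕ) : ℝ) * -r = -(2 * r) := by push_cast; ring
  rw [e]
  linarith

/-- Low frequency decay of the Fourier transformed solution. -/
theorem norm_flow_le_low (p : Params) : ∃ C c : ℝ, 0 < C ∧ 0 < c ∧ ∀ ω : ℝ, |ω| ≤ 1 →
    ∀ t, 0 ≤ t → ∀ x, ‖flow p ω t x‖ ≤ C * Real.exp (-(c * ω ^ 4 * t)) * ‖x‖ := by
  obtain ⟨C, c, hC, hc, h⟩ := Trajectory.low_decay p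
  refine ⟨√C, c / 2, by positivity, by positivity, fun ω hω t ht x =>
    norm_flow_le_of_energy_decay (fun T hT => ?_) (Real.sqrt_nonneg _) x⟩
  subst hT
  rw [Real.sq_sqrt hC.le]
  exact (h T hω t ht).trans_eq (by ring_nf)

/-- High frequency decay of the Fourier transformed solution. -/
theorem norm_flow_le_high (p : Params) : ∃ C c : ℝ, 0 < C ∧ 0 < c ∧ ∀ ω : ℝ, 1 ≤ |ω| →
    ∀ t, 0 ≤ t → ∀ x, ‖flow p ω t x‖ ≤ C * Real.exp (-(c * ω⁻¹ ^ 4 * t)) * ‖x‖ := by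
  obtain ⟨C, c, hC, hc, h⟩ := Trajectory.high_decay p
  refine ⟨√C, c / 2, by positivity, by positivity, fun ω hω t ht x =>
    norm_flow_le_of_energy_decay (fun T hT => ?_) (Real.sqrt_nonneg _) x⟩
  subst hT
  rw [Real.sq_sqrt hC.le]
  exact (h T hω t ht).trans_eq (by ring_nf)

/-- High frequency decay of the Fourier transformed solution for equal wave speeds. -/
theorem norm_flow_le_high_of_eq (p : Params) (h₁₂ : p.k₁ = p.k₂) (h₂₃ : p.k₂ = p.k₃) :
    ∃ C c : ℝ, 0 < C ∧ 0 < c ∧ ∀ ω : ℝ, 1 ≤ |ω| →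
    ∀ t, 0 ≤ t → ∀ x, ‖flow p ω t x‖ ≤ C * Real.exp (-(c * t)) * ‖x‖ := by
  obtain ⟨C, c, hC, hc, h⟩ := Trajectory.high_decay_of_eq p h₁₂ h₂₃
  refine ⟨√C, c / 2, by positivity, by positivity, fun ω hω t ht x =>
    norm_flow_le_of_energy_decay (fun T hT => ?_) (Real.sqrt_nonneg _) x⟩
  subst hT
  rw [Real.sq_sqrt hC.le]
  exact (h T hω t ht).trans_eq (by ring_nf)

end Symbol

open scoped ENNReal FourierTransform
open Filter Topology

/-! ### Weak evolution equations with bounded generator, and multipliers -/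

section WeakEvolution

/-- Pairing of an `L²` function with a Schwartz function. -/
def pairing (χ : 𝓢(ℝ, ℂ)) : L2 →L[ℂ] State :=
  (PointwiseConvergenceCLM.evalCLM (RingHom.id ℂ) State χ).comp
    (Lp.toTemperedDistributionCLM State (volume : Measure ℝ) 2)

lemma pairing_apply (χ : 𝓢(ℝ, ℂ)) (f : L2) : pairing χ f = (f : 𝓢'(ℝ, State)) χ := rfl

lemma pairing_eq_integral (χ : 𝓢(ℝ, ℂ)) (f : L2) : pairing χ f = ∫ x, χ x • f x := by
  rw [pairing_apply, Lp.toTemperedDistribution_apply]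

lemma toTemperedDistribution_injective {f g : L2}
    (h : (f : 𝓢'(ℝ, State)) = g) : f = g :=
  LinearMap.ker_eq_bot.1 (Lp.ker_toTemperedDistributionCLM_eq_bot (F := State)
    (μ := (volume : Measure ℝ)) (p := 2)) h

lemma eq_of_pairing_eq {f g : L2} (h : ∀ χ, pairing χ f = pairing χ g) : f = g := by
  apply toTemperedDistribution_injective
  ext χ : 1
  exact h χ

/-- A weak solution of a linear evolution equation with bounded generator is given by the
exponential series. -/
theorem eq_exp_of_weak_evolution {F : ℝ → L2} {P : L2 →L[ℂ] L2}
    (hF : ContinuousOn F (Set.Ici 0))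
    (h : ∀ t, 0 < t → ∀ χ, HasDerivAt (fun s => pairing χ (F s)) (pairing χ (P (F t))) t)
    {t : ℝ} (ht : 0 ≤ t) : F t = NormedSpace.exp (t • P) (F 0) := by
  have hmax : Continuous (fun s : ℝ => P (F (max s 0))) :=
    P.continuous.comp (hF.comp_continuous (continuous_id.max continuous_const)
      fun s => le_max_right s 0)
  -- Schwartz functions separate `L²`, so the weak equation integrates to an identity in `L²`. This
  -- makes `F` strongly differentiable and gives access to uniqueness for Lipschitz ODEs.
  have key : ∀ s, 0 ≤ s → F s = F 0 + ∫ r in (0 : ℝ)..s, P (F (max r 0)) := fun s hs => by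
    refine eq_of_pairing_eq fun χ => ?_
    rw [map_add, ← (pairing χ).intervalIntegral_comp_comm (hmax.intervalIntegrable _ _),
      intervalIntegral.integral_eq_sub_of_hasDerivAt_of_le hs (f := fun s => pairing χ (F s))]
    · abel
    · exact (pairing χ).continuous.comp_continuousOn (hF.mono Set.Icc_subset_Ici_self)
    · intro r hr
      rw [max_eq_left hr.1.le]
      exact h r hr.1 χ
    · exact ((pairing χ).continuous.comp hmax).intervalIntegrable _ _
  have h2 : Set.EqOn F (fun s => NormedSpace.exp (s • P) (F 0)) (Set.Icc 0 t) := by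
    have hexp : ∀ s : ℝ, HasDerivAt (fun s : ℝ => NormedSpace.exp (s • P) (F 0))
        (P (NormedSpace.exp (s • P) (F 0))) s := fun s =>
      ((ContinuousLinearMap.apply ℂ L2 (F 0)).restrictScalars ℝ).hasFDerivAt.comp_hasDerivAt s
        (hasDerivAt_exp_smul_const' (𝕂 := ℝ) P s)
    refine ODE_solution_unique (v := fun _ x => P x) (fun _ => P.lipschitz)
      (hF.mono Set.Icc_subset_Ici_self) (fun s hs => ?_)
      (fun s _ => (hexp s).continuousAt.continuousWithinAt)
      (fun s _ => (hexp s).hasDerivWithinAt) ?_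
    · have h3 : HasDerivAt (fun s => F 0 + ∫ r in (0 : ℝ)..s, P (F (max r 0)))
          (P (F (max s 0))) s :=
        (intervalIntegral.integral_hasDerivAt_right (hmax.intervalIntegrable _ _)
          (hmax.stronglyMeasurableAtFilter _ _) hmax.continuousAt).const_add _
      rw [max_eq_left hs.1] at h3
      exact h3.hasDerivWithinAt.congr (fun r hr => key r (hs.1.trans hr)) (key s hs.1)
    · rw [zero_smul ℝ P, NormedSpace.exp_zero, one_apply_eq_self]
  exact h2 (Set.right_mem_Icc.2 ht)

/-- Multiplication by a bounded operator valued function on `L²`. -/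
def multiplier {m : ℝ → State →L[ℂ] State} (hm : MemLp m ∞ volume) : L2 →L[ℂ] L2 :=
  (ContinuousLinearMap.id ℂ (State →L[ℂ] State)).holderL volume ∞ 2 2 hm.toLp

lemma coeFn_multiplier {m : ℝ → State →L[ℂ] State} (hm : MemLp m ∞ volume) (f : L2) :
    multiplier hm f =ᵐ[volume] fun x => m x (f x) := by
  refine (ContinuousLinearMap.coeFn_holder _ _ _).trans ?_
  filter_upwards [hm.coeFn_toLp] with x hx
  rw [hx]
  rfl

lemma coeFn_multiplier_pow {m : ℝ → State →L[ℂ] State} (hm : MemLp m ∞ volume) (f : L2) (n : ℕ) :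
    (multiplier hm ^ n) f =ᵐ[volume] fun x => (m x ^ n) (f x) := by
  induction n with
  | zero => simp
  | succ n ih =>
    rw [pow_succ', mul_apply_eq_comp]
    refine (coeFn_multiplier hm _).trans ?_
    filter_upwards [ih] with x hx
    rw [hx, pow_succ']
    rfl

/-- The exponential of a multiplication operator is computed pointwise. -/
theorem coeFn_exp_multiplier {m : ℝ → State →L[ℂ] State} (hm : MemLp m ∞ volume) (t : ℝ)
    (f : L2) : NormedSpace.exp (t • multiplier hm) f =ᵐ[volume]
      fun x => NormedSpace.exp (t • m x) (f x) := by
  set c : ℕ → ℂ := fun n => ((n.factorial : ℂ)⁻¹ * (t : ℂ) ^ n)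
  have hs : ∀ (V : Type) [NormedAddCommGroup V] [NormedSpace ℂ V] [CompleteSpace V]
      (A : V →L[ℂ] V) (x : V), Tendsto (fun N => ∑ n ∈ Finset.range N, c n • (A ^ n) x) atTop
        (𝓝 (NormedSpace.exp (t • A) x)) := fun V _ _ _ A x => by
    have h1 := (NormedSpace.exp_series_hasSum_exp' (𝕂 := ℂ) (t • A)).tendsto_sum_nat
    have h2 := ((ContinuousLinearMap.apply ℂ V x).continuous.tendsto _).comp h1
    refine h2.congr fun N => ?_
    simp only [Function.comp, map_sum, ContinuousLinearMap.apply_apply]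
    refine Finset.sum_congr rfl fun n _ => ?_
    rw [smul_pow, ← Complex.coe_smul, smul_smul]
    simp [c]
  -- The exponential series converges in `L²`, hence almost everywhere along a subsequence; its
  -- partial sums also converge pointwise, and the limits agree.
  obtain ⟨ns, hlim, hns⟩ := (tendstoInMeasure_of_tendsto_Lp
    (hs L2 (multiplier hm) f)).exists_seq_tendsto_ae'
  have hsum : ∀ N : ℕ, (∑ n ∈ Finset.range N, c n • (multiplier hm ^ n) f : L2) =ᵐ[volume]
      fun x => ∑ n ∈ Finset.range N, c n • (m x ^ n) (f x) := fun N => by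
    induction N with
    | zero =>
      simp only [Finset.range_zero, Finset.sum_empty]
      exact Lp.coeFn_zero State 2 (volume : Measure ℝ)
    | succ N ih =>
      rw [Finset.sum_range_succ]
      refine (Lp.coeFn_add _ _).trans ?_
      filter_upwards [ih, Lp.coeFn_smul (c N) ((multiplier hm ^ N) f),
        coeFn_multiplier_pow hm f N] with x h1 h2 h3
      rw [Pi.add_apply, h1, h2, Pi.smul_apply, h3, Finset.sum_range_succ]
  filter_upwards [hns, ae_all_iff.2 hsum] with x h1 h2
  refine tendsto_nhds_unique h1 ?_
  simp only [h2]
  exact (hs State (m x) (f x)).comp hlim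

end WeakEvolution

/-! ### Distributional derivatives on the Fourier side -/

section FourierSide

lemma derivCLM_eq_lineDeriv (f : 𝓢'(ℝ, State)) :
    TemperedDistribution.derivCLM State f = LineDeriv.lineDerivOp (1 : ℝ) f := by
  ext χ : 1
  rw [TemperedDistribution.derivCLM_apply_apply, TemperedDistribution.lineDerivOp_apply_apply]
  rfl

/-- The Fourier symbol of `∂ₓⁿ`. -/
def derivSymbol (n : ℕ) (ξ : ℝ) : ℂ := (Complex.I * ((2 * Real.pi * ξ : ℝ) : ℂ)) ^ n

lemma hasTemperateGrowth_derivSymbol (n : ℕ) : (derivSymbol n).HasTemperateGrowth := by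
  unfold derivSymbol
  fun_prop

lemma fourier_dx (n : ℕ) (f : L2) :
    𝓕 (dx n f) = TemperedDistribution.smulLeftCLM State (derivSymbol n)
      ((𝓕 f : L2) : 𝓢'(ℝ, State)) := by
  induction n with
  | zero =>
    have : derivSymbol 0 = fun _ => 1 := by ext; simp [derivSymbol]
    rw [this, TemperedDistribution.smulLeftCLM_const, one_smul]
    exact Lp.fourier_toTemperedDistribution_eq f
  | succ n ih =>
    have h1 : dx (n + 1) f = LineDeriv.lineDerivOp (1 : ℝ) (dx n f) := by
      rw [← derivCLM_eq_lineDeriv, dx, Function.iterate_succ_apply']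
      rfl
    have h2 : (fun x : ℝ => ((inner ℝ x 1 : ℝ) : ℂ)).HasTemperateGrowth := by fun_prop
    rw [h1, TemperedDistribution.fourier_lineDerivOp_eq, ih,
      TemperedDistribution.smulLeftCLM_smulLeftCLM_apply (hasTemperateGrowth_derivSymbol n) h2,
      ← smul_apply, ← TemperedDistribution.smulLeftCLM_smul
        ((hasTemperateGrowth_derivSymbol n).mul h2)]
    congr 2
    ext x
    simp [derivSymbol]
    ring

lemma dx_fourier_apply (n : ℕ) (f : L2) (χ : 𝓢(ℝ, ℂ)) :
    dx n f (𝓕 χ) = pairing (SchwartzMap.smulLeftCLM ℂ (derivSymbol n) χ) (𝓕 f) := by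
  rw [← TemperedDistribution.fourier_apply, fourier_dx]
  rfl

/-- An `L²` function is a distributional derivative if its Fourier transform is the right one. -/
lemma dx_eq_of_fourier {n : ℕ} {f g : L2}
    (h : (𝓕 g : L2) =ᵐ[volume] fun ξ => derivSymbol n ξ • (𝓕 f : L2) ξ) : dx n f = g := by
  have h1 : 𝓕 (dx n f) = 𝓕 (g : 𝓢'(ℝ, State)) := by
    rw [fourier_dx, Lp.fourier_toTemperedDistribution_eq]
    ext χ : 1
    rw [TemperedDistribution.smulLeftCLM_apply_apply, ← pairing_apply, ← pairing_apply,
      pairing_eq_integral, pairing_eq_integral]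
    refine integral_congr_ae ?_
    filter_upwards [h] with ξ hξ
    rw [hξ, SchwartzMap.smulLeftCLM_apply_apply (hasTemperateGrowth_derivSymbol n), smul_smul,
      smul_eq_mul, mul_comm]
  simpa using congrArg (fun T => 𝓕⁻ T) h1

lemma integrable_schwartz_smul (χ : 𝓢(ℝ, ℂ)) (f : L2) : Integrable (fun x => χ x • f x) :=
  memLp_one_iff_integrable.1 ((Lp.memLp f).smul (p := 2) (q := 2) (χ.memLp 2 volume))

lemma symbol_smul_apply (p : Params) (ξ : ℝ) (c : ℂ) (x : State) :
    c • symbol p (2 * Real.pi * ξ) x =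
      -(Matrix.toEuclideanCLM (𝕜 := ℂ) (A₂ p) ((derivSymbol 2 ξ * c) • x)
        + Matrix.toEuclideanCLM (𝕜 := ℂ) (A₁ p 0 0 1) ((derivSymbol 1 ξ * c) • x)
        + Matrix.toEuclideanCLM (𝕜 := ℂ) (A₀ p) ((derivSymbol 0 ξ * c) • x)) := by
  simp only [symbol, derivSymbol, map_smul, neg_apply, add_apply, smul_apply, smul_neg, smul_add,
    smul_smul, pow_one, pow_zero, one_mul]
  simp only [mul_comm c]

lemma continuous_symbol (p : Params) : Continuous (symbol p) := by
  unfold symbol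
  fun_prop

lemma exists_smooth_cutoff {a b : ℝ} (ha : 0 < a) (hab : a < b) : ∃ ρ : ℝ → ℂ,
    HasCompactSupport ρ ∧ ContDiff ℝ (⊤ : ℕ∞) ρ ∧ (∀ ξ, |ξ| ≤ a → ρ ξ = 1) ∧
    ∀ ξ, b ≤ |ξ| → ρ ξ = 0 := by
  let ρ : ContDiffBump (0 : ℝ) := ⟨a, b, ha, hab⟩
  refine ⟨fun ξ => (ρ ξ : ℂ), ρ.hasCompactSupport.comp_left (g := Complex.ofReal) rfl,
    Complex.ofRealCLM.contDiff.comp ρ.contDiff, fun ξ hξ => ?_, fun ξ hξ => ?_⟩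
  · simp only
    rw [ρ.one_of_mem_closedBall (by simpa using hξ), Complex.ofReal_one]
  · simp only
    rw [ρ.zero_of_le_dist (by simpa using hξ), Complex.ofReal_zero]

end FourierSide

/-! ### Identification of the solution with the flow -/

section FourierSolution

/-- The scalar multiplication operator by `ρ`, as an operator valued function. -/
def scalarSymbol (ρ : ℝ → ℂ) (ξ : ℝ) : State →L[ℂ] State := ρ ξ • ContinuousLinearMap.id ℂ State

lemma memLp_scalarSymbol {ρ : ℝ → ℂ} (hρ : Continuous ρ) (hρs : HasCompactSupport ρ) :
    MemLp (scalarSymbol ρ) ∞ volume := by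
  have hc : Continuous (scalarSymbol ρ) := hρ.smul continuous_const
  obtain ⟨C, hC⟩ := hρs.exists_bound_of_continuous hρ
  refine memLp_top_of_bound hc.aestronglyMeasurable
    (C * ‖ContinuousLinearMap.id ℂ State‖) (Eventually.of_forall fun ξ => ?_)
  rw [scalarSymbol, norm_smul]
  exact mul_le_mul_of_nonneg_right (hC ξ) (norm_nonneg _)

/-- The symbol of the generator, truncated to a bounded set of frequencies. -/
def truncatedSymbol (p : Params) (b : ℝ) : ℝ → State →L[ℂ] State :=
  (Metric.closedBall (0 : ℝ) b).indicator fun ξ => symbol p (2 * Real.pi * ξ)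

lemma truncatedSymbol_of_le (p : Params) {b ξ : ℝ} (h : |ξ| ≤ b) :
    truncatedSymbol p b ξ = symbol p (2 * Real.pi * ξ) :=
  Set.indicator_of_mem (by simpa using h) _

lemma memLp_truncatedSymbol (p : Params) (b : ℝ) : MemLp (truncatedSymbol p b) ∞ volume := by
  have hc : Continuous fun ξ => symbol p (2 * Real.pi * ξ) :=
    (continuous_symbol p).comp (continuous_const.mul continuous_id)
  obtain ⟨C, hC⟩ := (isCompact_closedBall (0 : ℝ) b).exists_bound_of_continuousOn hc.continuousOn
  refine memLp_top_of_bound (hc.aestronglyMeasurable.indicator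
    Metric.isClosed_closedBall.measurableSet) (max C 0) (Eventually.of_forall fun ξ => ?_)
  by_cases hξ : ξ ∈ Metric.closedBall (0 : ℝ) b
  · simp only [truncatedSymbol, Set.indicator_of_mem hξ]
    exact (hC ξ hξ).trans (le_max_left _ _)
  · simp [truncatedSymbol, Set.indicator_of_notMem hξ]

lemma pairing_scalar_multiplier {ρ : ℝ → ℂ} (hρ : ρ.HasTemperateGrowth)
    (hr : MemLp (scalarSymbol ρ) ∞ volume) (χ : 𝓢(ℝ, ℂ)) (f : L2) :
    pairing χ (multiplier hr f) = pairing (SchwartzMap.smulLeftCLM ℂ ρ χ) f := by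
  rw [pairing_eq_integral, pairing_eq_integral]
  refine integral_congr_ae ?_
  filter_upwards [coeFn_multiplier hr f] with ξ hξ
  rw [hξ, SchwartzMap.smulLeftCLM_apply_apply hρ, scalarSymbol, smul_apply,
    ContinuousLinearMap.id_apply, smul_smul, smul_eq_mul, mul_comm]

lemma clm_dx_fourier_apply (A : State →L[ℂ] State) (n : ℕ) (f : L2) (χ : 𝓢(ℝ, ℂ)) :
    A (dx n f (𝓕 χ)) = ∫ ξ, A ((derivSymbol n ξ * χ ξ) • (𝓕 f : L2) ξ) := by
  rw [dx_fourier_apply, pairing_eq_integral, ← A.integral_comp_comm (integrable_schwartz_smul _ _)]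
  simp only [SchwartzMap.smulLeftCLM_apply_apply (hasTemperateGrowth_derivSymbol n), smul_eq_mul]

lemma integrable_clm_derivSymbol (A : State →L[ℂ] State) (n : ℕ) (f : L2) (χ : 𝓢(ℝ, ℂ)) :
    Integrable (fun ξ => A ((derivSymbol n ξ * χ ξ) • f ξ)) := by
  have := A.integrable_comp (integrable_schwartz_smul
    (SchwartzMap.smulLeftCLM ℂ (derivSymbol n) χ) f)
  simpa only [SchwartzMap.smulLeftCLM_apply_apply (hasTemperateGrowth_derivSymbol n),
    smul_eq_mul] using this

lemma generator_fourier_apply (p : Params) (f : L2) (χ : 𝓢(ℝ, ℂ)) :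
    -(Matrix.toEuclideanCLM (𝕜 := ℂ) (A₂ p) (dx 2 f (𝓕 χ))
        + Matrix.toEuclideanCLM (𝕜 := ℂ) (A₁ p 0 0 1) (dx 1 f (𝓕 χ))
        + Matrix.toEuclideanCLM (𝕜 := ℂ) (A₀ p) (dx 0 f (𝓕 χ)))
      = ∫ ξ, χ ξ • symbol p (2 * Real.pi * ξ) ((𝓕 f : L2) ξ) := by
  have ei := fun (A : State →L[ℂ] State) n => integrable_clm_derivSymbol A n (𝓕 f) χ
  have h := integral_add ((ei (Matrix.toEuclideanCLM (𝕜 := ℂ) (A₂ p)) 2).add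
    (ei (Matrix.toEuclideanCLM (𝕜 := ℂ) (A₁ p 0 0 1)) 1))
    (ei (Matrix.toEuclideanCLM (𝕜 := ℂ) (A₀ p)) 0)
  simp only [Pi.add_apply] at h
  rw [clm_dx_fourier_apply, clm_dx_fourier_apply, clm_dx_fourier_apply,
    ← integral_add (ei _ _) (ei _ _), ← h, ← integral_neg]
  refine integral_congr_ae (Eventually.of_forall fun ξ => ?_)
  simp only [symbol_smul_apply]

/-- Testing the equation against `𝓕 (ρ χ)` localises it to `|ξ| < b`, where the unbounded symbol may
be replaced by its bounded truncation. -/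
lemma IsSolution.hasDerivAt_pairing_cutoff {p : Params} {U₀ : L2} {U : ℝ → L2}
    (h : IsSolution p 0 0 1 U₀ U) {b : ℝ} {ρ : ℝ → ℂ} (hρ : ρ.HasTemperateGrowth)
    (hr : MemLp (scalarSymbol ρ) ∞ volume) (hρ0 : ∀ ξ, b ≤ |ξ| → ρ ξ = 0) {s : ℝ} (hs : 0 < s)
    (χ : 𝓢(ℝ, ℂ)) :
    HasDerivAt (fun s => pairing χ (multiplier hr (𝓕 (U s))))
      (pairing χ (multiplier (memLp_truncatedSymbol p b) (multiplier hr (𝓕 (U s))))) s := by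
  have h0 := h.equation s hs (𝓕 (SchwartzMap.smulLeftCLM ℂ ρ χ))
  have e0 : ∀ s, dx 0 (U s) (𝓕 (SchwartzMap.smulLeftCLM ℂ ρ χ))
      = pairing χ (multiplier hr (𝓕 (U s))) := fun s => by
    rw [pairing_scalar_multiplier hρ, dx_fourier_apply]
    congr 2
    ext ξ
    rw [SchwartzMap.smulLeftCLM_apply_apply (hasTemperateGrowth_derivSymbol 0), derivSymbol,
      pow_zero, one_smul]
  rw [generator_fourier_apply] at h0
  simp only [e0] at h0
  refine h0.congr_deriv ?_
  rw [pairing_eq_integral]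
  refine integral_congr_ae ?_
  filter_upwards [coeFn_multiplier (memLp_truncatedSymbol p b) (multiplier hr (𝓕 (U s))),
    coeFn_multiplier hr (𝓕 (U s))] with ξ h2 h3
  rw [h2, h3, SchwartzMap.smulLeftCLM_apply_apply hρ, scalarSymbol, smul_apply,
    ContinuousLinearMap.id_apply, map_smul, smul_smul, smul_eq_mul, mul_comm]
  rcases le_total |ξ| b with hξ | hξ
  · rw [truncatedSymbol_of_le p hξ]
  · simp only [hρ0 ξ hξ, mul_zero, zero_smul]

/-- The Fourier transform of the solution is given by the flow of the symbol. -/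
theorem IsSolution.fourier_eq_flow {p : Params} {U₀ : L2} {U : ℝ → L2}
    (h : IsSolution p 0 0 1 U₀ U) {t : ℝ} (ht : 0 ≤ t) :
    (𝓕 (U t) : L2) =ᵐ[volume] fun ξ => flow p (2 * Real.pi * ξ) t ((𝓕 U₀ : L2) ξ) := by
  have main : ∀ R : ℕ, ∀ᵐ ξ : ℝ, |ξ| ≤ R →
      (𝓕 (U t) : L2) ξ = flow p (2 * Real.pi * ξ) t ((𝓕 U₀ : L2) ξ) := fun R => by
    -- The radius `R + 1` is positive even for `R = 0`.
    obtain ⟨ρ, hρs, hρd, hρ1, hρ0⟩ := exists_smooth_cutoff (a := R + 1) (b := R + 2)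
      (by positivity) (by linarith)
    have hρ := hρs.hasTemperateGrowth hρd
    have hr := memLp_scalarSymbol hρd.continuous hρs
    have hF : ContinuousOn (fun s => multiplier hr (𝓕 (U s))) (Set.Ici 0) :=
      ((multiplier hr).continuous.comp (Lp.fourierTransformₗᵢ ℝ State).continuous).comp_continuousOn
        h.continuousOn
    have hfin := eq_exp_of_weak_evolution hF
      (fun s hs χ => h.hasDerivAt_pairing_cutoff hρ hr hρ0 hs χ) ht
    simp only [h.initial] at hfin
    filter_upwards [coeFn_exp_multiplier (memLp_truncatedSymbol p (R + 2)) t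
      (multiplier hr (𝓕 U₀)), coeFn_multiplier hr (𝓕 U₀), coeFn_multiplier hr (𝓕 (U t))]
      with ξ h1 h2 h3 hξ
    rw [← hfin, h2, h3, truncatedSymbol_of_le p (hξ.trans (by linarith)), scalarSymbol,
      hρ1 ξ (hξ.trans (by linarith)), one_smul] at h1
    exact h1
  filter_upwards [ae_all_iff.2 main] with ξ hξ
  obtain ⟨R, hR⟩ := exists_nat_ge |ξ|
  exact hξ R hR

end FourierSolution

/-! ### Bounds on the transform of the data -/

section FourierBounds

/-- The `L²` Fourier transform of an integrable function is given by the Fourier integral. -/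
lemma fourier_ae_eq_fourierIntegral {f : L2} (hf : Integrable (f : ℝ → State)) :
    (𝓕 f : L2) =ᵐ[volume] (𝓕 (f : ℝ → State) : ℝ → State) := by
  have hc : Continuous (𝓕 (f : ℝ → State) : ℝ → State) :=
    VectorFourier.fourierIntegral_continuous Real.continuous_fourierChar
      (by exact continuous_inner) hf
  refine ae_eq_of_integral_contDiff_smul_eq ((Lp.memLp _).locallyIntegrable one_le_two)
    hc.locallyIntegrable fun g hg hgs => ?_
  have hgs' : HasCompactSupport (fun x => (g x : ℂ)) := hgs.comp_left (g := Complex.ofReal) rfl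
  have hg' : ContDiff ℝ (⊤ : ℕ∞) (fun x => (g x : ℂ)) := Complex.ofRealCLM.contDiff.comp hg
  set χ : 𝓢(ℝ, ℂ) := hgs'.toSchwartzMap hg' with hχ
  have h1 : pairing χ (𝓕 f) = ∫ x, (𝓕 χ) x • f x := by
    rw [pairing_apply, ← Lp.fourier_toTemperedDistribution_eq, TemperedDistribution.fourier_apply,
      ← pairing_apply, pairing_eq_integral]
  have h2 : ∫ x, (𝓕 χ) x • f x = ∫ x, χ x • (𝓕 (f : ℝ → State) : ℝ → State) x := by
    have := VectorFourier.integral_fourierIntegral_smul_eq_flip (L := innerₗ ℝ)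
      (μ := volume) (ν := volume) Real.continuous_fourierChar
      (by exact continuous_inner) χ.integrable hf
    rw [flip_innerₗ] at this
    exact this
  have h3 : ∀ x, χ x = (g x : ℂ) := fun x => rfl
  rw [pairing_eq_integral, h2] at h1
  simpa only [h3, Complex.coe_smul] using h1

lemma norm_fourier_le_integral {f : L2} (hf : Integrable (f : ℝ → State)) :
    ∀ᵐ ξ, ‖(𝓕 f : L2) ξ‖ ≤ ∫ x, ‖f x‖ := by
  filter_upwards [fourier_ae_eq_fourierIntegral hf] with ξ hξ
  rw [hξ]
  exact VectorFourier.norm_fourierIntegral_le_integral_norm _ _ _ _ _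

lemma norm_derivSymbol (n : ℕ) (ξ : ℝ) : ‖derivSymbol n ξ‖ = |2 * Real.pi * ξ| ^ n := by
  rw [derivSymbol, norm_pow, norm_mul, Complex.norm_I, one_mul, Complex.norm_real, Real.norm_eq_abs]

/-- The Fourier transform of the derivatives of a Sobolev function is square integrable. -/
lemma memLp_derivSymbol_smul_fourier {N n : ℕ} (hn : n ≤ N) {f : L2}
    (hf : TemperedDistribution.MemSobolev (N : ℝ) 2 (f : 𝓢'(ℝ, State))) :
    MemLp (fun ξ => derivSymbol n ξ • (𝓕 f : L2) ξ) 2 volume := by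
  obtain ⟨g, hg⟩ := TemperedDistribution.memSobolev_iff_exists_smulLeftCLM_fourier.1 hf
  rw [Lp.fourier_toTemperedDistribution_eq] at hg
  set w : ℝ → ℂ := fun ξ => (((1 + ‖ξ‖ ^ 2) ^ (-(N : ℝ) / 2) : ℝ) : ℂ) with hw
  have hwt : w.HasTemperateGrowth := by fun_prop
  have hwn : ∀ ξ, ‖w ξ‖ = (1 + ‖ξ‖ ^ 2) ^ (-(N : ℝ) / 2) := fun ξ => by
    rw [hw, Complex.norm_real, Real.norm_of_nonneg (by positivity)]
  have hwb : MemLp w ∞ volume := by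
    refine memLp_top_of_bound hwt.1.continuous.aestronglyMeasurable 1
      (Eventually.of_forall fun ξ => ?_)
    rw [hwn]
    exact Real.rpow_le_one_of_one_le_of_nonpos (by nlinarith [sq_nonneg ‖ξ‖])
      (by have : (0 : ℝ) ≤ N := by positivity
          linarith)
  -- Here `g` is `(1 + |ξ|²) ^ (N/2)` times the transform of `f`; undoing the weight gives a
  -- pointwise formula.
  have h1 : (hwb.toLp w • g : L2) = 𝓕 f := by
    apply toTemperedDistribution_injective
    rw [Lp.toTemperedDistribution_smul_eq hwt hwb, ← hg,
      TemperedDistribution.smulLeftCLM_smulLeftCLM_apply (by fun_prop) hwt]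
    have h2 : (fun ξ : ℝ => (((1 + ‖ξ‖ ^ 2) ^ ((N : ℝ) / 2) : ℝ) : ℂ)) * w = fun _ => 1 := by
      ext ξ
      have h3 : (0 : ℝ) < 1 + ‖ξ‖ ^ 2 := by positivity
      simp only [Pi.mul_apply, hw]
      rw [← Complex.ofReal_mul, ← Real.rpow_add h3, neg_div, add_neg_cancel, Real.rpow_zero,
        Complex.ofReal_one]
    rw [h2, TemperedDistribution.smulLeftCLM_const, one_smul]
  refine MemLp.of_le_mul (Lp.memLp g) (c := (2 * Real.pi) ^ n)
    ((hasTemperateGrowth_derivSymbol n).1.continuous.aestronglyMeasurable.smul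
      (Lp.aestronglyMeasurable _)) ?_
  filter_upwards [Lp.coeFn_lpSMul (hwb.toLp w) g (r := 2), hwb.coeFn_toLp] with ξ h2 h3
  rw [← h1, h2, Pi.smul_apply', h3, norm_smul, norm_smul, ← mul_assoc, norm_derivSymbol, hwn]
  refine mul_le_mul_of_nonneg_right ?_ (norm_nonneg _)
  rw [abs_mul, abs_of_pos Real.two_pi_pos, mul_pow, mul_assoc]
  refine mul_le_of_le_one_right (by positivity) ?_
  have h4 : |ξ| ^ n ≤ (1 + ‖ξ‖ ^ 2) ^ ((N : ℝ) / 2) := by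
    have h5 : |ξ| ≤ (1 + ‖ξ‖ ^ 2) ^ ((1 : ℝ) / 2) := by
      rw [← Real.sqrt_eq_rpow]
      refine Real.le_sqrt_of_sq_le ?_
      rw [Real.norm_eq_abs]
      linarith
    have h6 : (1 : ℝ) ≤ (1 + ‖ξ‖ ^ 2) ^ ((1 : ℝ) / 2) :=
      Real.one_le_rpow (by nlinarith [sq_nonneg ‖ξ‖]) (by norm_num)
    calc |ξ| ^ n ≤ ((1 + ‖ξ‖ ^ 2) ^ ((1 : ℝ) / 2)) ^ n := by gcongr
      _ ≤ ((1 + ‖ξ‖ ^ 2) ^ ((1 : ℝ) / 2)) ^ N := pow_le_pow_right₀ h6 hn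
      _ = _ := by
        rw [← Real.rpow_natCast, ← Real.rpow_mul (by positivity)]
        congr 1
        ring
  calc |ξ| ^ n * (1 + ‖ξ‖ ^ 2) ^ (-(N : ℝ) / 2)
      ≤ (1 + ‖ξ‖ ^ 2) ^ ((N : ℝ) / 2) * (1 + ‖ξ‖ ^ 2) ^ (-(N : ℝ) / 2) := by gcongr
    _ = 1 := by
      rw [← Real.rpow_add (by positivity)]
      ring_nf
      simp

end FourierBounds

/-! ### Conversion of pointwise rates into powers of time -/

section DecayRates

/-- The `L²` norm of the low frequency profile. -/
lemma exists_lp_low_profile (j : ℕ) {c : ℝ} (hc : 0 < c) : ∃ K : ℝ, 0 ≤ K ∧ ∀ s : ℝ, 0 < s →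
    ∃ G : Lp ℝ 2 (volume : Measure ℝ),
      (G =ᵐ[volume] fun ξ => |2 * Real.pi * ξ| ^ j * Real.exp (-(c * (2 * Real.pi * ξ) ^ 4 * s))) ∧
      ‖G‖ ≤ K * s ^ (-(1 / 8 : ℝ) - (j : ℝ) / 4) := by
  set B : ℝ := 2 * c * (2 * Real.pi) ^ 4 with hB
  have hB0 : 0 < B := by positivity
  set q : ℝ := 2 * j with hq
  have hq0 : 0 ≤ q := by positivity
  set A : ℝ := (2 * Real.pi) ^ (2 * j) *
    (2 * (B ^ (-(q + 1) / 4) * (1 / 4) * Real.Gamma ((q + 1) / 4))) with hA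
  have hΓ : 0 < Real.Gamma ((q + 1) / 4) := Real.Gamma_pos_of_pos (by positivity)
  have hA0 : 0 < A := by positivity
  refine ⟨√A, by positivity, fun s hs => ?_⟩
  set g : ℝ → ℝ := fun ξ =>
    |2 * Real.pi * ξ| ^ j * Real.exp (-(c * (2 * Real.pi * ξ) ^ 4 * s)) with hg
  have hgc : Continuous g := by fun_prop
  have hsq : ∀ ξ, g ξ ^ 2 = (fun x : ℝ => (2 * Real.pi) ^ (2 * j) *
      (x ^ q * Real.exp (-(B * s) * x ^ (4 : ℝ)))) |ξ| := fun ξ => by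
    simp only [hg, hq]
    have e1 : |ξ| ^ (2 * (j : ℝ)) = |ξ| ^ (2 * j) := by
      rw [← Real.rpow_natCast]; push_cast; rfl
    have e2 : |ξ| ^ (4 : ℝ) = ξ ^ 4 := by
      rw [show (4 : ℝ) = ((4 : ℕ) : ℝ) by norm_num, Real.rpow_natCast, Even.pow_abs (by decide)]
    rw [e1, e2, mul_pow, ← Real.exp_nat_mul, abs_mul, abs_of_pos Real.two_pi_pos, ← pow_mul, mul_pow,
      mul_comm j 2, hB, mul_assoc]
    congr 3
    push_cast
    ring
  have hint : ∫ ξ, g ξ ^ 2 = A * s ^ (-(q + 1) / 4) := by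
    simp only [hsq]
    rw [integral_comp_abs (f := fun x : ℝ => (2 * Real.pi) ^ (2 * j) *
      (x ^ q * Real.exp (-(B * s) * x ^ (4 : ℝ)))), integral_const_mul,
      integral_rpow_mul_exp_neg_mul_rpow (by norm_num) (by linarith) (by positivity),
      Real.mul_rpow hB0.le hs.le, hA]
    ring
  -- The integral of a non-integrable function is `0` by convention, so its positive value proves
  -- integrability.
  have hgi : Integrable (fun ξ => g ξ ^ 2) := by
    by_contra h
    rw [integral_undef h] at hint
    have : 0 < A * s ^ (-(q + 1) / 4) := by positivity
    linarith
  have hgm : MemLp g 2 volume :=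
    (memLp_two_iff_integrable_sq hgc.aestronglyMeasurable).2 hgi
  refine ⟨hgm.toLp g, hgm.coeFn_toLp, ?_⟩
  refine le_of_sq_le_sq ?_ (by positivity)
  rw [← real_inner_self_eq_norm_sq, L2.inner_def, mul_pow, Real.sq_sqrt hA0.le,
    ← Real.rpow_natCast (s ^ _), ← Real.rpow_mul hs.le]
  have h1 : ∫ ξ, inner ℝ (hgm.toLp g ξ) (hgm.toLp g ξ) = ∫ ξ, g ξ ^ 2 := by
    refine integral_congr_ae ?_
    filter_upwards [hgm.coeFn_toLp] with ξ hξ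
    rw [hξ, real_inner_self_eq_norm_sq, Real.norm_eq_abs, sq_abs]
  rw [h1, hint]
  apply le_of_eq
  congr 2
  rw [hq]
  push_cast
  ring

lemma exists_rpow_mul_exp_le (l : ℕ) {c : ℝ} (hc : 0 < c) : ∃ K : ℝ, 0 < K ∧ ∀ x : ℝ, 0 ≤ x →
    x ^ ((l : ℝ) / 4) * Real.exp (-(c * x)) ≤ K := by
  refine ⟨1 + l.factorial / c ^ l, by positivity, fun x hx => ?_⟩
  have h1 : x ^ ((l : ℝ) / 4) ≤ 1 + x ^ l := by
    rcases le_total x 1 with h | h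
    · have := Real.rpow_le_one hx h (by positivity : 0 ≤ (l : ℝ) / 4)
      have := pow_nonneg hx l
      linarith
    · have : x ^ ((l : ℝ) / 4) ≤ x ^ (l : ℝ) :=
        Real.rpow_le_rpow_of_exponent_le h (by
          have : (0 : ℝ) ≤ l := by positivity
          linarith)
      rw [Real.rpow_natCast] at this
      linarith
  have h2 : x ^ l ≤ l.factorial / c ^ l * Real.exp (c * x) := by
    have := Real.pow_div_factorial_le_exp (c * x) (by positivity) l
    rw [div_le_iff₀ (by positivity), mul_pow] at this
    rw [div_mul_eq_mul_div, le_div_iff₀ (by positivity)]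
    linarith
  have h3 : 1 ≤ Real.exp (c * x) := Real.one_le_exp (by positivity)
  rw [Real.exp_neg, ← div_eq_mul_inv, div_le_iff₀ (Real.exp_pos _)]
  linarith

/-- Boundedness of `x ^ (l/4) * exp (-c x)` at `x = ω⁻¹ ^ 4 * (1 + t)`; passing from `t` to `1 + t`
costs `exp c`, as `|ω⁻¹| ≤ 1`. -/
lemma exists_high_profile_le (l : ℕ) {c : ℝ} (hc : 0 < c) : ∃ K : ℝ, 0 < K ∧ ∀ ω : ℝ, 1 ≤ |ω| →
    ∀ t, 0 ≤ t → Real.exp (-(c * ω⁻¹ ^ 4 * t)) ≤ K * (1 + t) ^ (-(l : ℝ) / 4) * |ω| ^ l := by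
  obtain ⟨K, hK, h⟩ := exists_rpow_mul_exp_le l hc
  refine ⟨Real.exp c * K, by positivity, fun ω hω t ht => ?_⟩
  have hω0 : 0 < |ω| := by linarith
  set r := |ω|⁻¹ with hr
  have hr0 : 0 < r := by positivity
  have hr1 : r ≤ 1 := inv_le_one_of_one_le₀ hω
  have hr4 : ω⁻¹ ^ 4 = r ^ 4 := by rw [hr, ← abs_inv, Even.pow_abs (by decide)]
  have h1 := h (r ^ 4 * (1 + t)) (by positivity)
  have e1 : (r ^ 4 * (1 + t)) ^ ((l : ℝ) / 4) = r ^ l * (1 + t) ^ ((l : ℝ) / 4) := by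
    rw [Real.mul_rpow (by positivity) (by positivity), ← Real.rpow_natCast r 4,
      ← Real.rpow_mul hr0.le, ← Real.rpow_natCast r l]
    congr 2
    push_cast
    ring
  rw [e1] at h1
  have h2 : Real.exp (-(c * r ^ 4 * t)) ≤ Real.exp c * Real.exp (-(c * (r ^ 4 * (1 + t)))) := by
    rw [← Real.exp_add]
    refine Real.exp_le_exp.2 ?_
    have : r ^ 4 ≤ 1 := pow_le_one₀ hr0.le hr1
    nlinarith
  have e2 : (1 + t) ^ (-(l : ℝ) / 4) = ((1 + t) ^ ((l : ℝ) / 4))⁻¹ := by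
    rw [neg_div, Real.rpow_neg (by positivity)]
  have e3 : |ω| ^ l = (r ^ l)⁻¹ := by rw [hr, inv_pow, inv_inv]
  rw [hr4, e2, e3]
  have hp : 0 < (1 + t) ^ ((l : ℝ) / 4) := by positivity
  have hp' : 0 < r ^ l := by positivity
  rw [← div_eq_mul_inv, ← div_eq_mul_inv, le_div_iff₀ hp', le_div_iff₀ hp]
  calc Real.exp (-(c * r ^ 4 * t)) * r ^ l * (1 + t) ^ ((l : ℝ) / 4)
      ≤ Real.exp c * Real.exp (-(c * (r ^ 4 * (1 + t)))) * r ^ l * (1 + t) ^ ((l : ℝ) / 4) := by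
        gcongr
    _ = Real.exp c * (r ^ l * (1 + t) ^ ((l : ℝ) / 4) * Real.exp (-(c * (r ^ 4 * (1 + t))))) := by
        ring
    _ ≤ Real.exp c * K := by gcongr

/-- The high frequency factor of the decay estimate. -/
def highRate (p : Params) (l : ℕ) (c t : ℝ) : ℝ :=
  open Classical in if p.k₁ = p.k₂ ∧ p.k₂ = p.k₃ then Real.exp (-c * t)
    else (1 + t) ^ (-(l : ℝ) / 4)

lemma exists_norm_flow_le_highRate (p : Params) (l : ℕ) : ∃ C c : ℝ, 0 < C ∧ 0 < c ∧
    ∀ ω : ℝ, 1 ≤ |ω| → ∀ t, 0 ≤ t → ∀ x,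
      ‖flow p ω t x‖ ≤ C * highRate p l c t * (|ω| ^ l * ‖x‖) := by
  by_cases hp : p.k₁ = p.k₂ ∧ p.k₂ = p.k₃
  · obtain ⟨C, c, hC, hc, h⟩ := norm_flow_le_high_of_eq p hp.1 hp.2
    refine ⟨C, c, hC, hc, fun ω hω t ht x => (h ω hω t ht x).trans ?_⟩
    rw [highRate, if_pos hp, neg_mul]
    gcongr
    exact le_mul_of_one_le_left (norm_nonneg x) (one_le_pow₀ hω)
  · obtain ⟨C, c, hC, hc, h⟩ := norm_flow_le_high p
    obtain ⟨K, hK, hK'⟩ := exists_high_profile_le l hc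
    refine ⟨C * K, c, by positivity, hc, fun ω hω t ht x => (h ω hω t ht x).trans ?_⟩
    rw [highRate, if_neg hp]
    calc C * Real.exp (-(c * ω⁻¹ ^ 4 * t)) * ‖x‖
        ≤ C * (K * (1 + t) ^ (-(l : ℝ) / 4) * |ω| ^ l) * ‖x‖ := by gcongr; exact hK' ω hω t ht
      _ = _ := by ring

/-- The shift to `1 + t` avoids the singularity of the profile norm at time `0`. -/
lemma exists_norm_flow_le_lowProfile (p : Params) : ∃ C c : ℝ, 0 < C ∧ 0 < c ∧
    ∀ ω : ℝ, |ω| ≤ 1 → ∀ t, 0 ≤ t → ∀ x,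
      ‖flow p ω t x‖ ≤ C * Real.exp (-(c * ω ^ 4 * (1 + t))) * ‖x‖ := by
  obtain ⟨C, c, hC, hc, h⟩ := norm_flow_le_low p
  refine ⟨C * Real.exp c, c, by positivity, hc, fun ω hω t ht x => (h ω hω t ht x).trans ?_⟩
  rw [mul_assoc C (Real.exp c), ← Real.exp_add]
  gcongr
  have h1 : ω ^ 4 ≤ 1 := by
    rw [← Even.pow_abs (by decide : Even 4)]; exact pow_le_one₀ (abs_nonneg _) hω
  nlinarith

end DecayRates

/-! ### Assembly by Plancherel and splitting at `|ω| = 1` -/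

section Estimate

lemma exists_dx_eq_of_memLp {n : ℕ} {f : L2} {g : ℝ → State}
    (hg : g =ᵐ[volume] fun ξ => derivSymbol n ξ • (𝓕 f : L2) ξ) (hgm : MemLp g 2 volume) :
    ∃ V : L2, dx n f = V ∧ (𝓕 V : L2) =ᵐ[volume] g := by
  have h : (𝓕 (𝓕⁻ (hgm.toLp g)) : L2) = hgm.toLp g := FourierTransform.fourier_fourierInv_eq _
  refine ⟨𝓕⁻ (hgm.toLp g), dx_eq_of_fourier ?_, ?_⟩ <;> rw [h]
  · exact hgm.coeFn_toLp.trans hg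
  · exact hgm.coeFn_toLp

/-- A function dominated by an `L²` function on a set and by another one off this set is square
integrable, with the corresponding bound for any `L²` function of the same size. -/
lemma memLp_and_norm_le_of_split {g : ℝ → State} (hg : AEStronglyMeasurable g volume)
    {s : Set ℝ} (hs : MeasurableSet s) {E F : Type*} [NormedAddCommGroup E] [NormedAddCommGroup F]
    {G : Lp E 2 (volume : Measure ℝ)} {H : Lp F 2 (volume : Measure ℝ)} {a b : ℝ}
    (h₁ : ∀ᵐ ξ, ξ ∈ s → ‖g ξ‖ ≤ a * ‖G ξ‖) (h₂ : ∀ᵐ ξ, ξ ∉ s → ‖g ξ‖ ≤ b * ‖H ξ‖)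
    (ha : 0 ≤ a) (hb : 0 ≤ b) :
    MemLp g 2 volume ∧ ∀ V : L2, V =ᵐ[volume] g → ‖V‖ ≤ a * ‖G‖ + b * ‖H‖ := by
  have b₁ : ∀ᵐ ξ, ‖s.indicator g ξ‖ ≤ a * ‖G ξ‖ := by
    filter_upwards [h₁] with ξ h
    by_cases hξ : ξ ∈ s
    · rw [Set.indicator_of_mem hξ]; exact h hξ
    · rw [Set.indicator_of_notMem hξ, norm_zero]; positivity
  have b₂ : ∀ᵐ ξ, ‖sᶜ.indicator g ξ‖ ≤ b * ‖H ξ‖ := by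
    filter_upwards [h₂] with ξ h
    by_cases hξ : ξ ∈ s
    · rw [Set.indicator_of_notMem (by simpa using hξ), norm_zero]; positivity
    · rw [Set.indicator_of_mem (by simpa using hξ)]; exact h hξ
  have m₁ : MemLp (s.indicator g) 2 volume :=
    MemLp.of_le_mul (Lp.memLp G) (hg.indicator hs) b₁
  have m₂ : MemLp (sᶜ.indicator g) 2 volume :=
    MemLp.of_le_mul (Lp.memLp H) (hg.indicator hs.compl) b₂
  have hsum : s.indicator g + sᶜ.indicator g = g := Set.indicator_self_add_compl s g
  refine ⟨hsum ▸ m₁.add m₂, fun V hV => ?_⟩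
  have hV' : V = m₁.toLp _ + m₂.toLp _ := by
    rw [← MemLp.toLp_add]
    refine Lp.ext (hV.trans ?_)
    exact hsum.symm.eventuallyEq.trans (m₁.add m₂).coeFn_toLp.symm
  rw [hV']
  refine (norm_add_le _ _).trans (add_le_add ?_ ?_)
  · refine Lp.norm_le_mul_norm_of_ae_le_mul ?_
    filter_upwards [b₁, m₁.coeFn_toLp] with ξ h h'
    rwa [h']
  · refine Lp.norm_le_mul_norm_of_ae_le_mul ?_
    filter_upwards [b₂, m₂.coeFn_toLp] with ξ h h'
    rwa [h']

/-- The decay estimate for the derivatives of the solution. -/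
theorem exists_decay_estimate (p : Params) (N l j : ℕ) (hj : j + l ≤ N) :
    ∃ C c : ℝ, 0 < C ∧ 0 < c ∧ ∀ (U₀ : L2) (U : ℝ → L2),
      TemperedDistribution.MemSobolev (N : ℝ) 2 (U₀ : 𝓢'(ℝ, State)) →
      Integrable (U₀ : ℝ → State) volume → IsSolution p 0 0 1 U₀ U →
      ∃ V₀ : L2, dx (j + l) U₀ = V₀ ∧ ∀ t : ℝ, 0 ≤ t → ∃ V : L2, dx j (U t) = V ∧
        ‖V‖ ≤ C * (1 + t) ^ (-(1 / 8 : ℝ) - (j : ℝ) / 4) * (∫ x, ‖U₀ x‖)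
          + C * highRate p l c t * ‖V₀‖ := by
  obtain ⟨C₁, c₁, hC₁, hc₁, hlow⟩ := exists_norm_flow_le_lowProfile p
  obtain ⟨C₂, c₂, hC₂, hc₂, hhigh⟩ := exists_norm_flow_le_highRate p l
  obtain ⟨K, hK, hprofile⟩ := exists_lp_low_profile j hc₁
  refine ⟨C₁ * K + C₂, c₂, by positivity, hc₂, fun U₀ U hS hI hU => ?_⟩
  obtain ⟨V₀, hV₀, hV₀'⟩ := exists_dx_eq_of_memLp (EventuallyEq.refl _ _)
    (memLp_derivSymbol_smul_fourier hj hS)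
  refine ⟨V₀, hV₀, fun t ht => ?_⟩
  obtain ⟨G, hG, hGn⟩ := hprofile (1 + t) (by positivity)
  set M := ∫ x, ‖U₀ x‖
  have hM : 0 ≤ M := integral_nonneg fun x => norm_nonneg _
  have hr : 0 ≤ highRate p l c₂ t := by
    unfold highRate
    split_ifs <;> positivity
  have hms : MeasurableSet {ξ : ℝ | |2 * Real.pi * ξ| ≤ 1} :=
    (isClosed_le (by fun_prop) continuous_const).measurableSet
  have hmeas : AEStronglyMeasurable (fun ξ => derivSymbol j ξ • (𝓕 (U t) : L2) ξ) volume :=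
    (hasTemperateGrowth_derivSymbol j).1.continuous.aestronglyMeasurable.smul
      (Lp.aestronglyMeasurable _)
  -- Domination on the two frequency regions yields both the `L²` regularity of the derivative at
  -- time `t` and its bound.
  obtain ⟨hmem, hnorm⟩ := memLp_and_norm_le_of_split hmeas hms (G := G) (H := (𝓕 V₀ : L2))
    (a := C₁ * M) (b := C₂ * highRate p l c₂ t)
    (by
      filter_upwards [hU.fourier_eq_flow ht, hG, norm_fourier_le_integral hI] with ξ h1 h2 h3 hξ
      rw [norm_smul, norm_derivSymbol, h1, h2, norm_mul, norm_pow, Real.norm_eq_abs, abs_abs,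
        Real.norm_of_nonneg (Real.exp_pos _).le]
      calc |2 * Real.pi * ξ| ^ j * ‖flow p (2 * Real.pi * ξ) t ((𝓕 U₀ : L2) ξ)‖
          ≤ |2 * Real.pi * ξ| ^ j * (C₁ * Real.exp (-(c₁ * (2 * Real.pi * ξ) ^ 4 * (1 + t)))
            * M) := by
            gcongr
            exact (hlow _ hξ t ht _).trans (by gcongr)
        _ = _ := by ring)
    (by
      filter_upwards [hU.fourier_eq_flow ht, hV₀'] with ξ h1 h2 hξ
      rw [norm_smul, norm_derivSymbol, h1, h2, norm_smul, norm_derivSymbol]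
      have hξ' : 1 ≤ |2 * Real.pi * ξ| := (not_le.1 hξ).le
      calc |2 * Real.pi * ξ| ^ j * ‖flow p (2 * Real.pi * ξ) t ((𝓕 U₀ : L2) ξ)‖
          ≤ |2 * Real.pi * ξ| ^ j * (C₂ * highRate p l c₂ t *
            (|2 * Real.pi * ξ| ^ l * ‖(𝓕 U₀ : L2) ξ‖)) := by
            gcongr
            exact hhigh _ hξ' t ht _
        _ = _ := by rw [pow_add]; ring)
    (by positivity) (by positivity)
  obtain ⟨V, hV, hV'⟩ := exists_dx_eq_of_memLp (EventuallyEq.refl _ _) hmem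
  refine ⟨V, hV, ?_⟩
  have h1 := hnorm _ hV'
  rw [Lp.norm_fourier_eq, Lp.norm_fourier_eq] at h1
  refine h1.trans (add_le_add ?_ ?_)
  · calc C₁ * M * ‖G‖ ≤ C₁ * M * (K * (1 + t) ^ (-(1 / 8 : ℝ) - (j : ℝ) / 4)) := by gcongr
      _ = C₁ * K * (1 + t) ^ (-(1 / 8 : ℝ) - (j : ℝ) / 4) * M := by ring
      _ ≤ _ := by
        gcongr
        linarith
  · gcongr
    have : 0 ≤ C₁ * K := by positivity
    linarith

end Estimate

end LaminatedBeam

end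

theorem theorem3p7 (p : LaminatedBeam.Params) (N l : ℕ) (hl : 1 ≤ l) (hlN : l ≤ N)
    (j : ℕ) (hj : j ≤ N - l) :
    ∃ c₀ c₁ : ℝ, 0 < c₀ ∧ 0 < c₁ ∧
      ∀ (U₀ : LaminatedBeam.L2) (U : ℝ → LaminatedBeam.L2),
        TemperedDistribution.MemSobolev (N : ℝ) 2 (U₀ : 𝓢'(ℝ, LaminatedBeam.State)) →
        Integrable (U₀ : ℝ → LaminatedBeam.State) volume →
        LaminatedBeam.IsSolution p 0 0 1 U₀ U →
        ∃ V₀ : LaminatedBeam.L2, LaminatedBeam.dx (j + l) U₀ = V₀ ∧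
          ∀ t : ℝ, 0 ≤ t → ∃ V : LaminatedBeam.L2, LaminatedBeam.dx j (U t) = V ∧
            ((p.k₁ = p.k₂ ∧ p.k₂ = p.k₃) →
              ‖V‖ ≤ c₀ * (1 + t) ^ (-(1 / 8 : ℝ) - (j : ℝ) / 4) * (∫ x, ‖U₀ x‖)
                + c₀ * Real.exp (-c₁ * t) * ‖V₀‖) ∧
            (¬ (p.k₁ = p.k₂ ∧ p.k₂ = p.k₃) →
              ‖V‖ ≤ c₀ * (1 + t) ^ (-(1 / 8 : ℝ) - (j : ℝ) / 4) * (∫ x, ‖U₀ x‖)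
                + c₀ * (1 + t) ^ (-(l : ℝ) / 4) * ‖V₀‖) := by
  obtain ⟨C, c, hC, hc, h⟩ := LaminatedBeam.exists_decay_estimate p N l j (by omega)
  refine ⟨C, c, hC, hc, fun U₀ U hS hI hU => ?_⟩
  obtain ⟨V₀, hV₀, h⟩ := h U₀ U hS hI hU
  refine ⟨V₀, hV₀, fun t ht => ?_⟩
  obtain ⟨V, hV, h⟩ := h t ht
  refine ⟨V, hV, fun hp => ?_, fun hp => ?_⟩
  · rwa [LaminatedBeam.highRate, if_pos hp] at h
  · rwa [LaminatedBeam.highRate, if_neg hp] at h
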